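/- Let $d\ge 1$ be an integer and let $0<s<1$ with $d>2s$. For $0<\sigma<1$ and $\phi\in C_c^\infty(\mathbb{R}^d)$ let $$(-\Delta)^{\sigma}\phi(x)=\mathrm{p.v.}\;C_{d,\sigma}\int_{\mathbb{R}^d}\frac{\phi(x)-\phi(y)}{|x-y|^{d+2\sigma}}\,dy,\qquad C_{d,\sigma}=\Big(\int_{\mathbb{R}^d}\frac{1-\cos\zeta_1}{|\zeta|^{d+2\sigma}}\,d\zeta\Big)^{-1},$$ and for a function $u\in L^\infty(\mathbb{R}^d)$ let $(-\Delta)^{\sigma}u$ be understood in the sense of distributions, i.e. $(-\Delta)^\sigma u=g\in L^1_{\rm loc}(\mathbb{R}^d)$ means $\int u\,(-\Delta)^\sigma\phi\,dx=\int g\,\phi\,dx$ for all $\phi\in C_c^\infty(\mathbb{R}^d)$. Let $\dot H^s(\mathbb{R}^d)$ be the closure (as a space of functions) of $C_c^\infty(\mathbb{R}^d)$ with respect to the norm $$\|\phi\|_{\dot H^s}^2=\frac{C_{d,s}}{2}\int_{\mathbb{R}^d}\int_{\mathbb{R}^d}\frac{(\phi(x)-\phi(y))^2}{|x-y|^{d+2s}}\,dx\,dy,$$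 i.e. the set of functions $v$ for which there are $\phi_n\in C_c^\infty(\mathbb{R}^d)$ with $\|\phi_n-v\|_{\dot H^s}\to0$ and $\phi_n\to v$ almost everywhere. Then for every nonnegative $v\in L^\infty(\mathbb{R}^d)\cap\dot H^s(\mathbb{R}^d)$ such that $(-\Delta)^s v\in L^1(\mathbb{R}^d)$, and for every $q>1$, the function $v^{q-1}(-\Delta)^s v$ is integrable, $(-\Delta)^{s/2}(v^{q/2})$ belongs to $L^2(\mathbb{R}^d)$, and $$\int_{\mathbb{R}^d} v^{q-1}(x)\,(-\Delta)^s v(x)\,dx\;\ge\;\frac{4(q-1)}{q^2}\int_{\mathbb{R}^d}\big|(-\Delta)^{s/2}\big(v^{q/2}\big)(x)\big|^2\,dx .$$ -/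

import Mathlib

open MeasureTheory Filter Topology
open scoped ENNReal ContDiff

noncomputable section

namespace FracLap

/-- Euclidean space `ℝ^d`. -/
abbrev E (d : ℕ) : Type := EuclideanSpace ℝ (Fin d)

/-- Test functions: real-valued, smooth and compactly supported. -/
def IsTest {d : ℕ} (φ : E d → ℝ) : Prop :=
  ContDiff ℝ ∞ φ ∧ HasCompactSupport φ

/-- The normalising constant `C_{d,s} = (∫ (1 - cos ζ₁) / |ζ|^{d+2s} dζ)⁻¹` for which the
singular integral below has Fourier symbol `|ξ|^{2s}`. -/
def fracConst (d : ℕ) [NeZero d] (s : ℝ) : ℝ :=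
  (∫ ζ : E d, (1 - Real.cos (ζ 0)) / ‖ζ‖ ^ ((d : ℝ) + 2 * s))⁻¹

/-- `(-Δ)^s φ (x) = p.v. C_{d,s} ∫ (φ(x) - φ(y)) / |x-y|^{d+2s} dy`. It is only ever applied to
test functions with `0 < s < 1`, for which the principal value exists at every point. -/
def fracLap {d : ℕ} [NeZero d] (s : ℝ) (φ : E d → ℝ) (x : E d) : ℝ :=
  fracConst d s * limUnder (𝓝[>] (0 : ℝ)) (fun ε : ℝ =>
    ∫ y in {y : E d | ε < ‖x - y‖}, (φ x - φ y) / ‖x - y‖ ^ ((d : ℝ) + 2 * s))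

/-- `(-Δ)^s u = g` in the sense of distributions, where `g` is a locally integrable function:
`∫ u (-Δ)^s φ = ∫ g φ` for every test function `φ`. -/
def HasFracLap {d : ℕ} [NeZero d] (s : ℝ) (u g : E d → ℝ) : Prop :=
  LocallyIntegrable g volume ∧
  ∀ φ : E d → ℝ, IsTest φ →
    Integrable (fun x => u x * fracLap s φ x) volume ∧
    ∫ x, u x * fracLap s φ x = ∫ x, g x * φ x

/-- The squared homogeneous norm
`(C_{d,s} / 2) ∫∫ (u(x) - u(y))² / |x-y|^{d+2s} dx dy`, with values in `[0,∞]`. -/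
def hdotSq {d : ℕ} [NeZero d] (s : ℝ) (u : E d → ℝ) : ℝ≥0∞ :=
  ENNReal.ofReal (fracConst d s / 2) *
    ∫⁻ x : E d, ∫⁻ y : E d, ENNReal.ofReal ((u x - u y) ^ 2 / ‖x - y‖ ^ ((d : ℝ) + 2 * s))

/-- Membership in the homogeneous space `Ḣ^s(ℝ^d)`, the closure of the test functions with
respect to `hdotSq`, realised as a space of functions: `v` is a limit of test functions both in
the homogeneous norm and almost everywhere. (The norm alone does not see additive constants;
the almost everywhere convergence selects the representative in the completion.) -/
def MemHdot {d : ℕ} [NeZero d] (s : ℝ) (v : E d → ℝ) : Prop :=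
  ∃ φ : ℕ → E d → ℝ, (∀ n, IsTest (φ n)) ∧
    Tendsto (fun n => hdotSq s (fun x => φ n x - v x)) atTop (𝓝 0) ∧
    ∀ᵐ x : E d, Tendsto (fun n => φ n x) atTop (𝓝 (v x))

end FracLap

end

/-! Formally, testing the equation with `v^(q-1)` turns the left side into `C/2 ∬ (v(x)-v(y))
(v(x)^(q-1)-v(y)^(q-1)) |x-y|^(-d-2s)`. The pointwise inequality `stroock_varopoulos` bounds this
below by `4(q-1)/q²` times the `Ḣ^s` energy of `v^(q/2)`, and that energy is the squared `L²` norm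
of `(-Δ)^(s/2) v^(q/2)`.

Two points need care. First, `v^(q-1)` is not a test function, and `t^(q-1)`, `t^(q/2)` may fail to
be Lipschitz at `0`. They are replaced by `(t+δ)^p - δ^p`, cut off smoothly outside the range of
`v`. Composition with such functions preserves approximability by test functions (`Approx.comp`), so
they may be used in the equation (`Approx.weak_formulation`).

Second, `(-Δ)^(s/2) v^(q/2)` has to be produced as a function. Plancherel gives `(∫ u (-Δ)^(s/2) ψ)²
≤ energy(u) ‖ψ‖²` for test functions `u`, hence for their limits. Combined with the energy estimate,
this bounds the pairing with `v^(q/2)` by quantities that pass to the limit `δ → 0` by dominated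
convergence. Riesz representation (`exists_hasFracLap`) then supplies the `L²` function together
with the sharp norm bound. -/

noncomputable section

namespace FracLap

/-! ### The kernel, the normalising constant and the Fourier symbol. -/

variable {d : ℕ}

/-- The kernel `|z|^{-(d+2s)}`. -/
def kern (s : ℝ) (z : E d) : ℝ := (‖z‖ ^ ((d : ℝ) + 2 * s))⁻¹

lemma kern_nonneg (s : ℝ) (z : E d) : 0 ≤ kern s z := by unfold kern; positivity

lemma measurable_kern (s : ℝ) : Measurable (kern s : E d → ℝ) := by
  unfold kern; fun_prop

lemma kern_smul (s : ℝ) {a : ℝ} (ha : 0 < a) (z : E d) :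
    kern s (a • z) = (a ^ ((d : ℝ) + 2 * s))⁻¹ * kern s z := by
  rw [kern, norm_smul, Real.norm_of_nonneg ha.le, Real.mul_rpow ha.le (norm_nonneg _), mul_inv, kern]

variable [NeZero d]

/-- In polar coordinates the radial density is `r^(1-2s)` near `0`, integrable as `s < 1`, and
`r^(-1-2s)` at infinity, integrable as `s > 0`. All later integrability in `z` reduces to this. -/
lemma integrable_min_mul_kern {s : ℝ} (hs0 : 0 < s) (hs1 : s < 1) :
    Integrable (fun z : E d => min 1 (‖z‖ ^ 2) * kern s z) := by
  have hdp : 0 < d := Nat.pos_of_ne_zero (NeZero.ne d)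
  have hfr : Module.finrank ℝ (E d) = d := by simp
  have : Nontrivial (E d) := by
    apply Module.nontrivial_of_finrank_pos (R := ℝ)
    rw [hfr]; exact hdp
  have key := (integrable_fun_norm_addHaar (volume : Measure (E d))
    (f := fun r : ℝ => min 1 (r ^ 2) * (r ^ ((d : ℝ) + 2 * s))⁻¹)).2 ?_
  · exact key
  · rw [hfr]
    have e1 : Set.Ioi (0 : ℝ) = Set.Ioc 0 1 ∪ Set.Ioi 1 := by
      rw [Set.Ioc_union_Ioi_eq_Ioi zero_le_one]
    have pw : ∀ y : ℝ, 0 < y → y ^ (d - 1) * (y ^ ((d : ℝ) + 2 * s))⁻¹ = y ^ (-1 - 2 * s) := by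
      intro y hy
      rw [← Real.rpow_natCast, ← Real.rpow_neg hy.le, ← Real.rpow_add hy, Nat.cast_sub hdp]
      congr 1; push_cast; ring
    rw [e1, integrableOn_union]
    constructor
    · have h : IntegrableOn (fun y : ℝ => y ^ (1 - 2 * s)) (Set.Ioc 0 1) := by
        rw [← intervalIntegrable_iff_integrableOn_Ioc_of_le zero_le_one]
        exact intervalIntegral.intervalIntegrable_rpow' (by linarith)
      refine h.congr_fun (fun y hy => ?_) measurableSet_Ioc
      have h1 : y ^ 2 ≤ 1 := by nlinarith [hy.1, hy.2]
      simp only [smul_eq_mul]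
      rw [min_eq_right h1, mul_left_comm, pw y hy.1, ← Real.rpow_natCast, ← Real.rpow_add hy.1]
      congr 1; push_cast; ring
    · have h : IntegrableOn (fun y : ℝ => y ^ (-1 - 2 * s)) (Set.Ioi 1) :=
        integrableOn_Ioi_rpow_of_lt (by linarith) one_pos
      refine h.congr_fun (fun y hy => ?_) measurableSet_Ioi
      have hy' : (1 : ℝ) < y := hy
      have h1 : 1 ≤ y ^ 2 := by nlinarith
      simp only [smul_eq_mul]
      rw [min_eq_left h1, one_mul, pw y (by linarith)]

lemma one_sub_cos_le (t : ℝ) : 1 - Real.cos t ≤ 2 * min 1 (t ^ 2) := by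
  rcases le_total 1 (t ^ 2) with h | h
  · rw [min_eq_left h]; linarith [Real.neg_one_le_cos t]
  · rw [min_eq_right h]; nlinarith [Real.one_sub_sq_div_two_le_cos (x := t), sq_nonneg t]

lemma min_one_mul_sq_le (a r : ℝ) : min 1 (a ^ 2 * r ^ 2) ≤ (1 + a ^ 2) * min 1 (r ^ 2) := by
  rcases le_total 1 (r ^ 2) with h | h
  · rw [min_eq_left h]
    exact (min_le_left _ _).trans (by nlinarith [sq_nonneg a])
  · rw [min_eq_right h]
    exact (min_le_right _ _).trans (by nlinarith [sq_nonneg a, sq_nonneg r])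

lemma integrable_one_sub_cos_mul_kern {s : ℝ} (hs0 : 0 < s) (hs1 : s < 1) (ξ : E d) :
    Integrable (fun z : E d => (1 - Real.cos (inner ℝ ξ z)) * kern s z) := by
  refine ((integrable_min_mul_kern hs0 hs1).const_mul (2 * (1 + ‖ξ‖ ^ 2))).mono' ?_ ?_
  · have := measurable_kern (d := d) s
    exact Measurable.aestronglyMeasurable (by fun_prop)
  · refine Eventually.of_forall fun z => ?_
    have h0 : 0 ≤ 1 - Real.cos (inner ℝ ξ z) := by linarith [Real.cos_le_one (inner ℝ ξ z)]
    rw [Real.norm_of_nonneg (mul_nonneg h0 (kern_nonneg s z)), ← mul_assoc]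
    refine mul_le_mul_of_nonneg_right ?_ (kern_nonneg s z)
    have h1 : (inner ℝ ξ z) ^ 2 ≤ ‖ξ‖ ^ 2 * ‖z‖ ^ 2 := by
      rw [← mul_pow, ← sq_abs]
      exact pow_le_pow_left₀ (abs_nonneg _) (abs_real_inner_le_norm ξ z) 2
    calc 1 - Real.cos (inner ℝ ξ z) ≤ 2 * min 1 ((inner ℝ ξ z) ^ 2) := one_sub_cos_le _
      _ ≤ 2 * min 1 (‖ξ‖ ^ 2 * ‖z‖ ^ 2) := by gcongr
      _ ≤ 2 * ((1 + ‖ξ‖ ^ 2) * min 1 (‖z‖ ^ 2)) := by gcongr; exact min_one_mul_sq_le _ _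
      _ = _ := by ring

/-- The first basis vector. -/
def e0 : E d := EuclideanSpace.single 0 1

lemma inner_e0 (z : E d) : inner ℝ (e0 : E d) z = z 0 := by
  simp [e0, EuclideanSpace.inner_single_left]

lemma norm_e0 : ‖(e0 : E d)‖ = 1 := by simp [e0]

lemma fracConst_eq (s : ℝ) :
    fracConst d s = (∫ z : E d, (1 - Real.cos (inner ℝ (e0 : E d) z)) * kern s z)⁻¹ := by
  simp only [inner_e0, fracConst, kern, div_eq_mul_inv]

/-- The defining integral converges and its integrand is positive on the open slab `0 < z 0 < 1`, so
the inverse is not the default value `0`. -/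
lemma fracConst_pos {s : ℝ} (hs0 : 0 < s) (hs1 : s < 1) : 0 < fracConst d s := by
  rw [fracConst_eq, inv_pos]
  have hnn : ∀ z : E d, 0 ≤ (1 - Real.cos (inner ℝ (e0 : E d) z)) * kern s z := fun z =>
    mul_nonneg (by linarith [Real.cos_le_one (inner ℝ e0 z)]) (kern_nonneg s z)
  rw [integral_pos_iff_support_of_nonneg hnn (integrable_one_sub_cos_mul_kern hs0 hs1 e0)]
  have ho : IsOpen {z : E d | 0 < z 0 ∧ z 0 < 1} :=
    IsOpen.and (isOpen_lt continuous_const (by fun_prop)) (isOpen_lt (by fun_prop) continuous_const)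
  have hne : {z : E d | 0 < z 0 ∧ z 0 < 1}.Nonempty :=
    ⟨EuclideanSpace.single 0 (1 / 2), by simp; norm_num⟩
  refine (ho.measure_pos volume hne).trans_le (measure_mono fun z hz => ?_)
  have hz0 : z ≠ 0 := by rintro rfl; simpa using hz.1
  have hk : 0 < kern s z := by
    have := norm_pos_iff.2 hz0
    unfold kern; positivity
  have hc : Real.cos (z 0) < 1 := by
    rw [← Real.cos_zero]
    exact Real.cos_lt_cos_of_nonneg_of_le_pi le_rfl (by linarith [hz.2, Real.pi_gt_three]) hz.1
  rw [Function.mem_support, inner_e0]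
  exact (mul_pos (by linarith) hk).ne'

/-- The symbol of the singular integral. -/
lemma integral_one_sub_cos_mul_kern {s : ℝ} (hs0 : 0 < s) (hs1 : s < 1) (ξ : E d) :
    fracConst d s * ∫ z : E d, (1 - Real.cos (inner ℝ ξ z)) * kern s z = ‖ξ‖ ^ (2 * s) := by
  rcases eq_or_ne ξ 0 with rfl | hξ
  · simp [Real.zero_rpow (by linarith : (2 * s) ≠ 0)]
  have hr : 0 < ‖ξ‖ := norm_pos_iff.2 hξ
  set r := ‖ξ‖ with hrdef
  have hnorm : ‖ξ‖ = ‖r • (e0 : E d)‖ := by rw [norm_smul, norm_e0, Real.norm_of_nonneg hr.le, mul_one]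
  -- A reflection carrying `ξ` to `r e0` reduces to the direction of `e0`; the dilation `z ↦ r z`
  -- then yields `r^(d+2s) r^(-d) = r^(2s)`.
  set R := (ℝ ∙ (ξ - r • (e0 : E d)))ᗮ.reflection with hR
  have hRξ : R ξ = r • (e0 : E d) := Submodule.reflection_sub hnorm
  have h1 : ∫ z : E d, (1 - Real.cos (inner ℝ ξ z)) * kern s z
      = ∫ z : E d, (1 - Real.cos (inner ℝ (e0 : E d) (r • z))) * kern s z := by
    rw [← (R.measurePreserving).integral_comp R.toHomeomorph.measurableEmbedding
      (fun z => (1 - Real.cos (inner ℝ (e0 : E d) (r • z))) * kern s z)]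
    refine integral_congr_ae (Eventually.of_forall fun z => ?_)
    have h2 : inner ℝ (e0 : E d) (r • R z) = inner ℝ ξ z := by
      rw [inner_smul_right, ← real_inner_smul_left, ← hRξ, R.inner_map_map]
    have h3 : kern s (R z) = kern s z := by simp [kern, R.norm_map]
    simp only [h2, h3]
  have h4 : ∀ z : E d, (1 - Real.cos (inner ℝ (e0 : E d) (r • z))) * kern s z
      = r ^ ((d : ℝ) + 2 * s) * ((1 - Real.cos (inner ℝ (e0 : E d) (r • z))) * kern s (r • z)) := by
    intro z
    have : r ^ ((d : ℝ) + 2 * s) ≠ 0 := (Real.rpow_pos_of_pos hr _).ne'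
    rw [kern_smul s hr]; field_simp
  have hC := fracConst_pos (d := d) hs0 hs1
  have h5 : ∫ z : E d, (1 - Real.cos (inner ℝ (e0 : E d) z)) * kern s z = (fracConst d s)⁻¹ := by
    rw [fracConst_eq, inv_inv]
  rw [h1, funext h4, integral_const_mul,
    Measure.integral_comp_smul volume (fun z : E d => (1 - Real.cos (inner ℝ (e0 : E d) z)) * kern s z),
    h5, finrank_euclideanSpace_fin, abs_of_nonneg (by positivity), smul_eq_mul,
    Real.rpow_add hr, Real.rpow_natCast]
  field_simp

end FracLap
end

/-! ### Second differences, the singular integral and integration by parts. -/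

noncomputable section

namespace FracLap

variable {d : ℕ}

/-- The weighted symmetric second difference, whose integral in `z` is the singular integral. -/
def secDiff (s : ℝ) (φ : E d → ℝ) (p : E d × E d) : ℝ :=
  (φ p.1 - (φ (p.1 + p.2) + φ (p.1 - p.2)) / 2) * kern s p.2

/-- The weighted first difference, whose `L²` norm is the homogeneous Sobolev norm. -/
def incr (s : ℝ) (u : E d → ℝ) (p : E d × E d) : ℝ :=
  (u (p.1 + p.2) - u p.1) * √(kern s p.2)

lemma incr_mul_incr (s : ℝ) (u w : E d → ℝ) (p : E d × E d) :
    incr s u p * incr s w p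
      = (u (p.1 + p.2) - u p.1) * (w (p.1 + p.2) - w p.1) * kern s p.2 := by
  have h := Real.mul_self_sqrt (kern_nonneg s p.2)
  unfold incr
  linear_combination ((u (p.1 + p.2) - u p.1) * (w (p.1 + p.2) - w p.1)) * h

lemma measurable_incr (s : ℝ) {u : E d → ℝ} (hu : Measurable u) : Measurable (incr s u) := by
  have := measurable_kern (d := d) s
  unfold incr
  fun_prop

lemma measurable_secDiff (s : ℝ) {u : E d → ℝ} (hu : Measurable u) : Measurable (secDiff s u) := by
  have := measurable_kern (d := d) s
  unfold secDiff
  fun_prop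

lemma IsTest.continuous {φ : E d → ℝ} (hφ : IsTest φ) : Continuous φ := hφ.1.continuous

lemma IsTest.measurable {φ : E d → ℝ} (hφ : IsTest φ) : Measurable φ := hφ.continuous.measurable

lemma IsTest.integrable {φ : E d → ℝ} (hφ : IsTest φ) : Integrable φ :=
  hφ.continuous.integrable_of_hasCompactSupport hφ.2

lemma IsTest.exists_bound {φ : E d → ℝ} (hφ : IsTest φ) : ∃ M, 0 ≤ M ∧ ∀ x, |φ x| ≤ M := by
  obtain ⟨M, hM⟩ := hφ.2.exists_bound_of_continuous hφ.continuous
  exact ⟨M, (norm_nonneg _).trans (hM 0), hM⟩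

lemma IsTest.translate {φ : E d → ℝ} (hφ : IsTest φ) (z : E d) : IsTest fun x => φ (x + z) :=
  ⟨hφ.1.comp (contDiff_id.add contDiff_const),
    hφ.2.comp_homeomorph (Homeomorph.addRight z)⟩

lemma IsTest.sub {φ ψ : E d → ℝ} (hφ : IsTest φ) (hψ : IsTest ψ) : IsTest fun x => φ x - ψ x :=
  ⟨hφ.1.sub hψ.1, hφ.2.sub hψ.2⟩

/-- The second difference is `-(F x - F (x - z)) / 2` with `F y = φ (y + z) - φ y`. The gradient of
`φ` is Lipschitz, so that of `F` is at most `C‖z‖`, and the mean value inequality gives a second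
factor `‖z‖`. -/
lemma IsTest.abs_second_difference_le {φ : E d → ℝ} (hφ : IsTest φ) :
    ∃ C, 0 ≤ C ∧ ∀ x z, |φ x - (φ (x + z) + φ (x - z)) / 2| ≤ C * ‖z‖ ^ 2 := by
  have hφ' : ContDiff ℝ 1 (fderiv ℝ φ) := hφ.1.fderiv_right (by norm_cast)
  obtain ⟨C, hC⟩ := hφ'.lipschitzWith_of_hasCompactSupport (hφ.2.fderiv (𝕜 := ℝ)) one_ne_zero
  have hd : Differentiable ℝ φ := hφ.1.differentiable (by simp)
  refine ⟨C, C.2, fun x z => ?_⟩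
  set F : E d → ℝ := fun y => φ (y + z) - φ y with hF
  have hFd : ∀ y, HasFDerivAt F (fderiv ℝ φ (y + z) - fderiv ℝ φ y) y := fun y =>
    HasFDerivAt.sub ((hasFDerivAt_comp_add_right z).2 (hd (y + z)).hasFDerivAt)
      (hd y).hasFDerivAt
  have hb : ‖F x - F (x - z)‖ ≤ (C * ‖z‖) * ‖x - (x - z)‖ := by
    refine convex_univ.norm_image_sub_le_of_norm_hasFDerivWithin_le
      (fun y _ => (hFd y).hasFDerivWithinAt) (fun y _ => ?_) trivial trivial
    have := hC.dist_le_mul (y + z) y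
    rwa [dist_eq_norm, dist_eq_norm, add_sub_cancel_left] at this
  rw [sub_sub_cancel, Real.norm_eq_abs] at hb
  have e : φ x - (φ (x + z) + φ (x - z)) / 2 = -(F x - F (x - z)) / 2 := by
    simp only [hF, sub_add_cancel]; ring
  rw [e, abs_div, abs_neg, abs_two]
  have := abs_nonneg (F x - F (x - z))
  nlinarith

lemma IsTest.integrable_second_difference {φ : E d → ℝ} (hφ : IsTest φ) (z : E d) :
    Integrable fun x => φ x - (φ (x + z) + φ (x - z)) / 2 :=
  hφ.integrable.sub (((hφ.integrable.comp_add_right z).add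
    (hφ.integrable.comp_sub_right z)).div_const 2)

lemma IsTest.integral_abs_second_difference_le {φ : E d → ℝ} (hφ : IsTest φ) :
    ∃ C, 0 ≤ C ∧ ∀ z, ∫ x, |φ x - (φ (x + z) + φ (x - z)) / 2| ≤ C * min 1 (‖z‖ ^ 2) := by
  obtain ⟨C, hC0, hC⟩ := hφ.abs_second_difference_le
  obtain ⟨R, hR⟩ := hφ.2.isCompact.isBounded.subset_closedBall (0 : E d)
  set V := (volume : Measure (E d)).real (Metric.closedBall 0 (R + 1)) with hV
  have hN : 0 ≤ ∫ x, |φ x| := integral_nonneg fun _ => abs_nonneg _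
  -- The first summand serves `‖z‖ ≥ 1` by the triangle inequality. The second serves `‖z‖ ≤ 1`,
  -- where the second difference is supported in the ball of radius `R + 1`.
  refine ⟨2 * (∫ x, |φ x|) + C * V, by positivity, fun z => ?_⟩
  rcases le_total 1 (‖z‖ ^ 2) with h | h
  · rw [min_eq_left h, mul_one]
    have i1 := hφ.integrable.abs
    have i2 := i1.comp_add_right z
    have i3 := i1.comp_sub_right z
    have i4 : Integrable fun x => (|φ (x + z)| + |φ (x - z)|) / 2 := (i2.add i3).div_const 2
    calc ∫ x, |φ x - (φ (x + z) + φ (x - z)) / 2|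
        ≤ ∫ x, (|φ x| + (|φ (x + z)| + |φ (x - z)|) / 2) := by
          refine integral_mono (hφ.integrable_second_difference z).abs
            (i1.add i4) fun x => ?_
          refine (abs_sub _ _).trans ?_
          rw [abs_div, abs_two]
          gcongr
          exact abs_add_le _ _
      _ = 2 * ∫ x, |φ x| := by
          rw [integral_add i1 i4, integral_div, integral_add i2 i3,
            integral_add_right_eq_self (fun x => |φ x|), integral_sub_right_eq_self (fun x => |φ x|)]
          ring
      _ ≤ _ := by linarith [mul_nonneg hC0 (measureReal_nonneg : 0 ≤ V)]
  · rw [min_eq_right h]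
    have hz : ‖z‖ ≤ 1 := by nlinarith [norm_nonneg z]
    have hout : ∀ y : E d, R < ‖y‖ → φ y = 0 := fun y hy => by
      refine image_eq_zero_of_notMem_tsupport fun hmem => ?_
      have := hR hmem
      rw [mem_closedBall_zero_iff] at this
      linarith
    have hfin : volume (Metric.closedBall (0 : E d) (R + 1)) ≠ ⊤ :=
      (isCompact_closedBall _ _).measure_lt_top.ne
    calc ∫ x, |φ x - (φ (x + z) + φ (x - z)) / 2|
        ≤ ∫ x, (Metric.closedBall (0 : E d) (R + 1)).indicator (fun _ => C * ‖z‖ ^ 2) x := by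
          refine integral_mono (hφ.integrable_second_difference z).abs
            ((integrable_indicator_iff Metric.isClosed_closedBall.measurableSet).2
              (integrableOn_const hfin)) fun x => ?_
          by_cases hx : x ∈ Metric.closedBall (0 : E d) (R + 1)
          · rw [Set.indicator_of_mem hx]; exact hC x z
          · rw [Set.indicator_of_notMem hx]
            rw [mem_closedBall_zero_iff, not_le] at hx
            have h1 := norm_sub_le (x + z) z
            have h2 := norm_add_le (x - z) z
            rw [add_sub_cancel_right] at h1
            rw [sub_add_cancel] at h2
            simp only [hout x (by linarith), hout (x + z) (by linarith), hout (x - z) (by linarith)]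
            simp
      _ = C * V * ‖z‖ ^ 2 := by
          rw [integral_indicator Metric.isClosed_closedBall.measurableSet, setIntegral_const,
            smul_eq_mul]
          ring
      _ ≤ _ := by gcongr; linarith

variable [NeZero d] {s : ℝ}

lemma IsTest.integrable_secDiff (hs0 : 0 < s) (hs1 : s < 1) {φ : E d → ℝ} (hφ : IsTest φ) :
    Integrable (secDiff s φ) := by
  obtain ⟨C, hC0, hC⟩ := hφ.integral_abs_second_difference_le
  have hm := measurable_secDiff s hφ.measurable
  refine (integrable_prod_iff' hm.aestronglyMeasurable).2 ⟨Eventually.of_forall fun z =>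
    (hφ.integrable_second_difference z).mul_const (kern s z), ?_⟩
  refine ((integrable_min_mul_kern hs0 hs1).const_mul C).mono'
    hm.norm.stronglyMeasurable.integral_prod_left'.aestronglyMeasurable (Eventually.of_forall fun z => ?_)
  have e : ∀ x, ‖secDiff s φ (x, z)‖ = |φ x - (φ (x + z) + φ (x - z)) / 2| * kern s z := fun x => by
    rw [secDiff, norm_mul, Real.norm_of_nonneg (kern_nonneg s z), Real.norm_eq_abs]
  rw [Real.norm_of_nonneg (integral_nonneg fun _ => norm_nonneg _)]
  simp only [e]
  rw [integral_mul_const, ← mul_assoc]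
  exact mul_le_mul_of_nonneg_right (hC z) (kern_nonneg s z)

lemma integrableOn_kern (hs0 : 0 < s) (hs1 : s < 1) {ε : ℝ} (hε : 0 < ε) :
    IntegrableOn (kern s) {z : E d | ε < ‖z‖} := by
  have hms : MeasurableSet {z : E d | ε < ‖z‖} := measurableSet_lt measurable_const measurable_norm
  have hm : 0 < min 1 (ε ^ 2) := by positivity
  refine (((integrable_min_mul_kern hs0 hs1).const_mul (min 1 (ε ^ 2))⁻¹).integrableOn).mono'
    (measurable_kern s).aestronglyMeasurable ?_
  refine (ae_restrict_iff' hms).2 (Eventually.of_forall fun z hz => ?_)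
  have hz' : ε < ‖z‖ := hz
  rw [Real.norm_of_nonneg (kern_nonneg s z), ← mul_assoc]
  refine le_mul_of_one_le_left (kern_nonneg s z) ?_
  rw [inv_mul_eq_div, one_le_div hm]
  gcongr

/-- The substitutions `y = x + z` and `y = x - z` give the same truncated integral; averaging them
symmetrises the integrand. -/
lemma IsTest.setIntegral_eq (hs0 : 0 < s) (hs1 : s < 1) {φ : E d → ℝ} (hφ : IsTest φ) (x : E d)
    {ε : ℝ} (hε : 0 < ε) :
    ∫ y in {y : E d | ε < ‖x - y‖}, (φ x - φ y) / ‖x - y‖ ^ ((d : ℝ) + 2 * s)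
      = ∫ z, {z : E d | ε < ‖z‖}.indicator (fun z => secDiff s φ (x, z)) z := by
  obtain ⟨M, hM0, hM⟩ := hφ.exists_bound
  have hms : MeasurableSet {z : E d | ε < ‖z‖} := measurableSet_lt measurable_const measurable_norm
  have hms' : MeasurableSet {y : E d | ε < ‖x - y‖} :=
    measurableSet_lt measurable_const (by fun_prop)
  have hk := integrableOn_kern (d := d) hs0 hs1 hε
  have hI : ∀ g : E d → E d, Measurable g →
      IntegrableOn (fun z => (φ x - φ (g z)) * kern s z) {z : E d | ε < ‖z‖} := by
    intro g hg
    refine Integrable.bdd_mul (c := 2 * M) hk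
      (measurable_const.sub (hφ.measurable.comp hg)).aestronglyMeasurable
      (Eventually.of_forall fun z => ?_)
    have h1 := hM x
    have h2 := hM (g z)
    have h3 := abs_sub (φ x) (φ (g z))
    rw [Real.norm_eq_abs]
    linarith
  have hp := hI (fun z => x + z) (by fun_prop)
  have hn := hI (fun z => x - z) (by fun_prop)
  rw [← integral_indicator hms']
  set A := ∫ y, {y : E d | ε < ‖x - y‖}.indicator
    (fun y => (φ x - φ y) / ‖x - y‖ ^ ((d : ℝ) + 2 * s)) y with hA
  have e1 : A = ∫ z in {z : E d | ε < ‖z‖}, (φ x - φ (x + z)) * kern s z := by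
    rw [hA, ← integral_add_left_eq_self _ x, ← integral_indicator hms]
    refine integral_congr_ae (Eventually.of_forall fun z => ?_)
    simp [Set.indicator, kern, div_eq_mul_inv]
  have e2 : A = ∫ z in {z : E d | ε < ‖z‖}, (φ x - φ (x - z)) * kern s z := by
    rw [hA, ← integral_sub_left_eq_self _ volume x, ← integral_indicator hms]
    refine integral_congr_ae (Eventually.of_forall fun z => ?_)
    simp [Set.indicator, kern, div_eq_mul_inv]
  rw [integral_indicator hms]
  calc A = (A + A) / 2 := by ring
    _ = _ := by
      nth_rewrite 1 [e1]
      rw [e2, ← integral_add hp hn, ← integral_div]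
      refine integral_congr_ae (Eventually.of_forall fun z => ?_)
      simp only [secDiff]; ring

/-- After symmetrisation the integrand is absolutely integrable for almost every `x`, by Fubini, so
the principal value is a dominated limit. -/
lemma IsTest.fracLap_ae_eq (hs0 : 0 < s) (hs1 : s < 1) {φ : E d → ℝ} (hφ : IsTest φ) :
    ∀ᵐ x, fracLap s φ x = fracConst d s * ∫ z, secDiff s φ (x, z) := by
  filter_upwards [(hφ.integrable_secDiff hs0 hs1).prod_right_ae] with x hx
  unfold fracLap
  congr 1
  refine Tendsto.limUnder_eq ?_
  have hev : (fun ε : ℝ => ∫ z, {z : E d | ε < ‖z‖}.indicator (fun z => secDiff s φ (x, z)) z)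
      =ᶠ[𝓝[>] (0 : ℝ)] fun ε : ℝ =>
        ∫ y in {y : E d | ε < ‖x - y‖}, (φ x - φ y) / ‖x - y‖ ^ ((d : ℝ) + 2 * s) := by
    filter_upwards [self_mem_nhdsWithin] with ε hε
    exact (hφ.setIntegral_eq hs0 hs1 x hε).symm
  refine Tendsto.congr' hev ?_
  refine tendsto_integral_filter_of_dominated_convergence (fun z => ‖secDiff s φ (x, z)‖) ?_ ?_
    hx.norm ?_
  · exact Eventually.of_forall fun ε => hx.aestronglyMeasurable.indicator
      (measurableSet_lt measurable_const measurable_norm)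
  · exact Eventually.of_forall fun ε => Eventually.of_forall fun z => norm_indicator_le_norm_self _ _
  · refine Eventually.of_forall fun z => ?_
    rcases eq_or_ne z 0 with rfl | hz
    · have : secDiff s φ (x, 0) = 0 := by simp [secDiff]
      simp [Set.indicator, this]
    · refine tendsto_const_nhds.congr' ?_
      have : ∀ᶠ ε in 𝓝[>] (0 : ℝ), ε < ‖z‖ :=
        nhdsWithin_le_nhds (gt_mem_nhds (norm_pos_iff.2 hz))
      filter_upwards [this] with ε hε
      rw [Set.indicator_of_mem (by exact hε)]

section Bounded

variable {u φ : E d → ℝ} {M : ℝ}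

lemma IsTest.integrable_mul_secDiff (hs0 : 0 < s) (hs1 : s < 1) (hφ : IsTest φ)
    (hu : Measurable u) (hM : ∀ x, |u x| ≤ M) :
    Integrable fun p : E d × E d => u p.1 * secDiff s φ p :=
  Integrable.bdd_mul (c := M) (hφ.integrable_secDiff hs0 hs1)
    (hu.comp measurable_fst).aestronglyMeasurable (Eventually.of_forall fun p => hM p.1)

lemma IsTest.integrable_fracLap (hs0 : 0 < s) (hs1 : s < 1) (hφ : IsTest φ) :
    Integrable (fracLap s φ) :=
  ((hφ.integrable_secDiff hs0 hs1).integral_prod_left.const_mul (fracConst d s)).congr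
    ((hφ.fracLap_ae_eq hs0 hs1).mono fun _ h => h.symm)

lemma IsTest.integrable_mul_fracLap (hs0 : 0 < s) (hs1 : s < 1) (hφ : IsTest φ)
    (hu : Measurable u) (hM : ∀ x, |u x| ≤ M) :
    Integrable fun x => u x * fracLap s φ x :=
  Integrable.bdd_mul (c := M) (hφ.integrable_fracLap hs0 hs1) hu.aestronglyMeasurable
    (Eventually.of_forall fun x => hM x)

lemma IsTest.integral_mul_fracLap_eq (hs0 : 0 < s) (hs1 : s < 1) (hφ : IsTest φ)
    (hu : Measurable u) (hM : ∀ x, |u x| ≤ M) :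
    ∫ x, u x * fracLap s φ x = fracConst d s * ∫ p : E d × E d, u p.1 * secDiff s φ p := by
  rw [Measure.volume_eq_prod, integral_prod _ (hφ.integrable_mul_secDiff hs0 hs1 hu hM),
    ← integral_const_mul]
  refine integral_congr_ae ((hφ.fracLap_ae_eq hs0 hs1).mono fun x hx => ?_)
  simp only [hx, integral_const_mul]
  ring

omit [NeZero d] in
-- Integration by parts for fixed `z`: translating `x` by `z` in the term with `φ x - φ (x - z)`
-- moves a difference onto `u`.
lemma IsTest.integral_mul_second_difference (hφ : IsTest φ)
    (hu : Measurable u) (hM : ∀ x, |u x| ≤ M) (z : E d) :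
    ∫ x, u x * (φ x - (φ (x + z) + φ (x - z)) / 2)
      = (∫ x, (u (x + z) - u x) * (φ (x + z) - φ x)) / 2 := by
  have hI : ∀ w : E d → ℝ, Measurable w → (∀ x, |w x| ≤ M) →
      ∀ ψ : E d → ℝ, Integrable ψ → Integrable fun x => w x * ψ x :=
    fun w hw hwM ψ hψ => Integrable.bdd_mul (c := M) hψ hw.aestronglyMeasurable
      (Eventually.of_forall hwM)
  have hI1 : Integrable fun x => φ x - φ (x + z) := hφ.integrable.sub (hφ.integrable.comp_add_right z)
  have hI2 : Integrable fun x => φ x - φ (x - z) := hφ.integrable.sub (hφ.integrable.comp_sub_right z)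
  have hI3 : Integrable fun x => φ (x + z) - φ x := (hφ.integrable.comp_add_right z).sub hφ.integrable
  have e1 : ∫ x, u x * (φ x - φ (x - z)) = ∫ x, u (x + z) * (φ (x + z) - φ x) := by
    rw [← integral_add_right_eq_self _ z]
    simp only [add_sub_cancel_right]
  have e2 : ∫ x, u x * (φ x - (φ (x + z) + φ (x - z)) / 2)
      = ((∫ x, u x * (φ x - φ (x + z))) + ∫ x, u x * (φ x - φ (x - z))) / 2 := by
    rw [← integral_add (hI u hu hM _ hI1) (hI u hu hM _ hI2), ← integral_div]
    refine integral_congr_ae (Eventually.of_forall fun x => ?_)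
    simp only; ring
  rw [e2, e1, ← integral_add (hI u hu hM _ hI1)
    (hI (fun x => u (x + z)) (by fun_prop) (fun x => hM _) _ hI3)]
  congr 1
  refine integral_congr_ae (Eventually.of_forall fun x => ?_)
  simp only; ring

omit [NeZero d] in
lemma IsTest.integral_mul_secDiff_slice (hφ : IsTest φ)
    (hu : Measurable u) (hM : ∀ x, |u x| ≤ M) (z : E d) :
    ∫ x, u x * secDiff s φ (x, z) = (∫ x, incr s u (x, z) * incr s φ (x, z)) / 2 := by
  simp only [incr_mul_incr, secDiff, ← mul_assoc]
  rw [integral_mul_const, integral_mul_const, hφ.integral_mul_second_difference hu hM z]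
  ring

/-- The slice identity with `u = φ` expresses `∫ (incr s φ)² dx` as twice the slice integral of `φ ·
secDiff`, which is integrable in `z`. -/
lemma IsTest.memLp_incr (hs0 : 0 < s) (hs1 : s < 1) (hφ : IsTest φ) : MemLp (incr s φ) 2 := by
  obtain ⟨M, hM0, hM⟩ := hφ.exists_bound
  have hm := measurable_incr s hφ.measurable
  refine (memLp_two_iff_integrable_sq hm.aestronglyMeasurable).2 ?_
  refine (integrable_prod_iff' (hm.pow_const 2).aestronglyMeasurable).2
    ⟨Eventually.of_forall fun z => ?_, ?_⟩
  · have ht : IsTest fun x => φ (x + z) - φ x := (hφ.translate z).sub hφ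
    have h2 : Integrable fun x => (φ (x + z) - φ x) * (φ (x + z) - φ x) :=
      (ht.continuous.mul ht.continuous).integrable_of_hasCompactSupport (ht.2.mul_left)
    refine (h2.mul_const (kern s z)).congr (Eventually.of_forall fun x => ?_)
    simp only [sq, incr_mul_incr]
  · refine ((hφ.integrable_mul_secDiff hs0 hs1 hφ.measurable hM).integral_prod_right.const_mul
      2).congr (Eventually.of_forall fun z => ?_)
    simp only
    rw [hφ.integral_mul_secDiff_slice hφ.measurable hM z, mul_div_cancel₀ _ two_ne_zero]
    refine integral_congr_ae (Eventually.of_forall fun x => ?_)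
    simp only [norm_pow, Real.norm_eq_abs, sq_abs]
    rw [sq]

/-- Integration by parts: the distributional pairing is the bilinear form. -/
lemma IsTest.integral_mul_fracLap (hs0 : 0 < s) (hs1 : s < 1) (hφ : IsTest φ)
    (hu : Measurable u) (hM : ∀ x, |u x| ≤ M) (hu2 : MemLp (incr s u) 2) :
    ∫ x, u x * fracLap s φ x = fracConst d s / 2 * ∫ p, incr s u p * incr s φ p := by
  have hI : Integrable fun p => incr s u p * incr s φ p :=
    hu2.integrable_mul (hφ.memLp_incr hs0 hs1)
  rw [hφ.integral_mul_fracLap_eq hs0 hs1 hu hM, Measure.volume_eq_prod,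
    integral_prod_symm _ (hφ.integrable_mul_secDiff hs0 hs1 hu hM), integral_prod_symm _ hI]
  simp only [hφ.integral_mul_secDiff_slice hu hM]
  rw [integral_div]
  ring

end Bounded

end FracLap
end

/-! ### Convergence in energy, composition and the weak formulation. -/

noncomputable section

namespace FracLap

section L2

variable {α : Type*} {m : MeasurableSpace α} {μ : Measure α} {F G : α → ℝ}

lemma sq_integral_mul_le (hF : MemLp F 2 μ) (hG : MemLp G 2 μ) :
    (∫ x, F x * G x ∂μ) ^ 2 ≤ (∫ x, F x ^ 2 ∂μ) * ∫ x, G x ^ 2 ∂μ := by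
  have e : ∀ {F G : α → ℝ} (hF : MemLp F 2 μ) (hG : MemLp G 2 μ),
      inner ℝ (hF.toLp F) (hG.toLp G) = ∫ x, F x * G x ∂μ := by
    intro F G hF hG
    rw [L2.inner_def]
    refine integral_congr_ae ?_
    filter_upwards [hF.coeFn_toLp, hG.coeFn_toLp] with x h1 h2
    rw [h1, h2, real_inner_eq_re_inner]
    simp [mul_comm]
  have := real_inner_mul_inner_self_le (hF.toLp F) (hG.toLp G)
  rw [e hF hG, e hF hF, e hG hG] at this
  simpa only [sq] using this

lemma memLp_two_of_lintegral_lt_top (hF : AEStronglyMeasurable F μ)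
    (h : ∫⁻ x, ENNReal.ofReal (F x ^ 2) ∂μ < ⊤) : MemLp F 2 μ := by
  rw [memLp_two_iff_integrable_sq hF]
  exact ⟨hF.pow 2, (hasFiniteIntegral_iff_ofReal (Eventually.of_forall fun x => sq_nonneg _)).2 h⟩

variable {g : ℕ → α → ℝ}

lemma tendsto_integral_sq_sub (hF : MemLp F 2 μ) (hg : ∀ n, MemLp (g n) 2 μ)
    (h : Tendsto (fun n => ∫⁻ x, ENNReal.ofReal ((g n x - F x) ^ 2) ∂μ) atTop (𝓝 0)) :
    Tendsto (fun n => ∫ x, (g n x - F x) ^ 2 ∂μ) atTop (𝓝 0) := by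
  have h1 := (ENNReal.tendsto_toReal ENNReal.zero_ne_top).comp h
  refine h1.congr fun n => ?_
  exact (integral_eq_lintegral_of_nonneg_ae (Eventually.of_forall fun x => sq_nonneg _)
    ((((hg n).sub hF).aestronglyMeasurable).pow 2)).symm

lemma tendsto_integral_mul_of_tendsto_sq (hF : MemLp F 2 μ) (hG : MemLp G 2 μ)
    (hg : ∀ n, MemLp (g n) 2 μ)
    (h : Tendsto (fun n => ∫⁻ x, ENNReal.ofReal ((g n x - F x) ^ 2) ∂μ) atTop (𝓝 0)) :
    Tendsto (fun n => ∫ x, G x * g n x ∂μ) atTop (𝓝 (∫ x, G x * F x ∂μ)) := by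
  have h1 := tendsto_integral_sq_sub hF hg h
  have h2 : Tendsto (fun n => (∫ x, G x * (g n x - F x) ∂μ) ^ 2) atTop (𝓝 0) := by
    refine squeeze_zero (fun n => sq_nonneg _) (fun n => sq_integral_mul_le hG ((hg n).sub hF)) ?_
    simpa using h1.const_mul (∫ x, G x ^ 2 ∂μ)
  have h3 : Tendsto (fun n => ∫ x, G x * (g n x - F x) ∂μ) atTop (𝓝 0) := by
    have := (Real.continuous_sqrt.tendsto 0).comp h2
    rw [Real.sqrt_zero] at this
    exact (tendsto_zero_iff_abs_tendsto_zero _).2 (this.congr fun n => Real.sqrt_sq_eq_abs _)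
  have h4 := h3.add_const (∫ x, G x * F x ∂μ)
  rw [zero_add] at h4
  refine h4.congr fun n => ?_
  have i1 : Integrable (fun x => G x * (g n x - F x)) μ := hG.integrable_mul ((hg n).sub hF)
  have i2 : Integrable (fun x => G x * F x) μ := hG.integrable_mul hF
  rw [← integral_add i1 i2]
  refine integral_congr_ae (Eventually.of_forall fun x => ?_)
  simp only; ring

lemma tendsto_integral_sq_of_tendsto_sq (hF : MemLp F 2 μ) (hg : ∀ n, MemLp (g n) 2 μ)
    (h : Tendsto (fun n => ∫⁻ x, ENNReal.ofReal ((g n x - F x) ^ 2) ∂μ) atTop (𝓝 0)) :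
    Tendsto (fun n => ∫ x, g n x ^ 2 ∂μ) atTop (𝓝 (∫ x, F x ^ 2 ∂μ)) := by
  have h1 := tendsto_integral_sq_sub hF hg h
  have h2 := tendsto_integral_mul_of_tendsto_sq hF hF hg h
  have h3 := (h1.add (h2.const_mul 2)).sub_const (∫ x, F x * F x ∂μ)
  rw [zero_add, show 2 * (∫ x, F x * F x ∂μ) - ∫ x, F x * F x ∂μ = ∫ x, F x ^ 2 ∂μ by
    simp only [sq]; ring] at h3
  refine h3.congr fun n => ?_
  have i1 : Integrable (fun x => (g n x - F x) ^ 2) μ := ((hg n).sub hF).integrable_sq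
  have i2 : Integrable (fun x => F x * g n x) μ := hF.integrable_mul (hg n)
  have i3 : Integrable (fun x => F x * F x) μ := hF.integrable_mul hF
  have i4 : Integrable (fun x => (g n x - F x) ^ 2 + 2 * (F x * g n x)) μ := i1.add (i2.const_mul 2)
  rw [← integral_const_mul, ← integral_add i1 (i2.const_mul 2), ← integral_sub i4 i3]
  refine integral_congr_ae (Eventually.of_forall fun x => ?_)
  simp only; ring

end L2

variable {d : ℕ} {s : ℝ}

lemma incr_sub (u w : E d → ℝ) (p : E d × E d) :
    incr s (fun x => u x - w x) p = incr s u p - incr s w p := by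
  simp only [incr]; ring

lemma sq_incr_comp_le {h : ℝ → ℝ} {K : NNReal} (hh : LipschitzWith K h) (u : E d → ℝ)
    (p : E d × E d) : incr s (fun x => h (u x)) p ^ 2 ≤ K ^ 2 * incr s u p ^ 2 := by
  have h1 := hh.dist_le_mul (u (p.1 + p.2)) (u p.1)
  rw [Real.dist_eq, Real.dist_eq] at h1
  have h2 : (h (u (p.1 + p.2)) - h (u p.1)) ^ 2 ≤ (K * |u (p.1 + p.2) - u p.1|) ^ 2 := by
    rw [← sq_abs]; exact pow_le_pow_left₀ (abs_nonneg _) h1 2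
  rw [mul_pow, sq_abs] at h2
  have h3 : 0 ≤ √(kern s p.2) ^ 2 := sq_nonneg _
  simp only [incr, mul_pow]
  nlinarith [mul_le_mul_of_nonneg_right h2 h3]

lemma hdotSq_eq [NeZero d] {u : E d → ℝ} (hu : Measurable u) :
    hdotSq s u = ENNReal.ofReal (fracConst d s / 2) * ∫⁻ p, ENNReal.ofReal (incr s u p ^ 2) := by
  rw [hdotSq, Measure.volume_eq_prod, lintegral_prod _
    (((measurable_incr s hu).pow_const 2).ennreal_ofReal.aemeasurable)]
  congr 1
  refine lintegral_congr fun x => ?_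
  rw [← lintegral_add_left_eq_self _ x]
  refine lintegral_congr fun z => ?_
  rw [sq (incr s u (x, z)), incr_mul_incr]
  congr 1
  simp only [kern, sub_add_cancel_left, norm_neg, div_eq_mul_inv]
  ring

/-- `φ n` are test functions that converge to the measurable function `v` almost everywhere and
in the homogeneous Sobolev norm. -/
structure Approx (s : ℝ) (φ : ℕ → E d → ℝ) (v : E d → ℝ) : Prop where
  measurable : Measurable v
  isTest : ∀ n, IsTest (φ n)
  tendsto : Tendsto (fun n => ∫⁻ p, ENNReal.ofReal ((incr s (φ n) p - incr s v p) ^ 2)) atTop (𝓝 0)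
  ae_tendsto : ∀ᵐ x, Tendsto (fun n => φ n x) atTop (𝓝 (v x))

lemma IsTest.comp {h : ℝ → ℝ} (hh : ContDiff ℝ ∞ h) (h0 : h 0 = 0) {φ : E d → ℝ} (hφ : IsTest φ) :
    IsTest fun x => h (φ x) :=
  ⟨hh.comp hφ.1, hφ.2.comp_left h0⟩

variable [NeZero d] {φ : ℕ → E d → ℝ} {v : E d → ℝ}

/-- Finite energy of `v` comes from a single approximant at finite distance. -/
lemma Approx.memLp (hs0 : 0 < s) (hs1 : s < 1) (H : Approx s φ v) : MemLp (incr s v) 2 := by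
  obtain ⟨n, hn⟩ := ((H.tendsto.eventually (gt_mem_nhds one_pos))).exists
  have h1 := (H.isTest n).memLp_incr hs0 hs1
  have h2 : MemLp (fun p => incr s (φ n) p - incr s v p) 2 :=
    memLp_two_of_lintegral_lt_top ((measurable_incr s (H.isTest n).measurable).sub
      (measurable_incr s H.measurable)).aestronglyMeasurable (hn.trans ENNReal.one_lt_top)
  refine (h1.sub h2).ae_eq (Eventually.of_forall fun p => ?_)
  simp

/-- The Lipschitz bound alone controls the energy of `h ∘ φ n` but not its convergence. The a.e.
convergence supplies the rest, through a dominated convergence argument whose majorant is a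
convergent part plus a fixed integrable function. -/
lemma Approx.comp (hs0 : 0 < s) (hs1 : s < 1) (H : Approx s φ v) {h : ℝ → ℝ}
    (hh : ContDiff ℝ ∞ h) (h0 : h 0 = 0) {K : NNReal} (hK : LipschitzWith K h) :
    Approx s (fun n x => h (φ n x)) (fun x => h (v x)) := by
  have hmv : Measurable fun x => h (v x) := hh.continuous.measurable.comp H.measurable
  refine ⟨hmv, fun n => (H.isTest n).comp hh h0, ?_, ?_⟩
  · set A : ℕ → E d × E d → ℝ := fun n p =>
      (incr s (fun x => h (φ n x)) p - incr s (fun x => h (v x)) p) ^ 2 with hA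
    set B : ℕ → E d × E d → ℝ := fun n p => (incr s (φ n) p - incr s v p) ^ 2 with hB
    set D : E d × E d → ℝ := fun p => 6 * K ^ 2 * incr s v p ^ 2 with hD
    have hmA : ∀ n, Measurable (A n) := fun n =>
      ((measurable_incr s ((H.isTest n).comp hh h0).measurable).sub
        (measurable_incr s hmv)).pow_const 2
    have hDm : Measurable D := ((measurable_incr s H.measurable).pow_const 2).const_mul _
    have hDi : Integrable D := (H.memLp hs0 hs1).integrable_sq.const_mul _
    -- From `(a-b)² ≤ 2a² + 2b²`, used twice, `A ≤ 4K² B + D`. Hence `A ≤ 4K² B + min A D`: the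
    -- first term tends to zero in `L¹`, the second a.e. under the majorant `D`.
    have hle : ∀ n p, ENNReal.ofReal (A n p) ≤
        ENNReal.ofReal (4 * K ^ 2) * ENNReal.ofReal (B n p) + ENNReal.ofReal (min (A n p) (D p)) := by
      intro n p
      have h1 : A n p ≤ 4 * K ^ 2 * B n p + D p := by
        have a1 := sq_incr_comp_le (s := s) hK (φ n) p
        have a2 := sq_incr_comp_le (s := s) hK v p
        simp only [hA, hB, hD]
        nlinarith [sq_nonneg (incr s (fun x => h (φ n x)) p + incr s (fun x => h (v x)) p),
          mul_nonneg (sq_nonneg (K : ℝ)) (sq_nonneg (incr s (φ n) p - 2 * incr s v p))]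
      have h2 : 0 ≤ 4 * K ^ 2 * B n p := by simp only [hB]; positivity
      rw [← ENNReal.ofReal_mul (by positivity), ← ENNReal.ofReal_add h2
        (le_min (by simp only [hA]; positivity) (by simp only [hD]; positivity))]
      refine ENNReal.ofReal_le_ofReal ?_
      rcases le_total (A n p) (D p) with h3 | h3
      · rw [min_eq_left h3]; linarith
      · rw [min_eq_right h3]; exact h1
    have hfst : ∀ᵐ p : E d × E d, Tendsto (fun n => φ n p.1) atTop (𝓝 (v p.1)) :=
      Measure.quasiMeasurePreserving_fst.ae H.ae_tendsto
    -- Null sets pull back to null sets under addition.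
    have hadd : ∀ᵐ p : E d × E d, Tendsto (fun n => φ n (p.1 + p.2)) atTop (𝓝 (v (p.1 + p.2))) :=
      (quasiMeasurePreserving_add volume volume).ae H.ae_tendsto
    have hmin : Tendsto (fun n => ∫⁻ p, ENNReal.ofReal (min (A n p) (D p))) atTop (𝓝 0) := by
      have := tendsto_lintegral_of_dominated_convergence (μ := (volume : Measure (E d × E d)))
        (F := fun n p => ENNReal.ofReal (min (A n p) (D p))) (f := fun _ => 0)
        (fun p => ENNReal.ofReal (D p)) (fun n => ((hmA n).min hDm).ennreal_ofReal)
        (fun n => Eventually.of_forall fun p => ENNReal.ofReal_le_ofReal (min_le_right _ _))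
        ?_ ?_
      · simpa using this
      · have := (hasFiniteIntegral_iff_ofReal (Eventually.of_forall fun p => by
          simp only [hD, Pi.zero_apply]; positivity)).1 hDi.2
        exact this.ne
      · filter_upwards [hfst, hadd] with p h1 h2
        have hA0 : Tendsto (fun n => A n p) atTop (𝓝 0) := by
          have c1 := (hh.continuous.tendsto _).comp h1
          have c2 := (hh.continuous.tendsto _).comp h2
          have := ((((c2.sub c1).mul_const √(kern s p.2))).sub_const
            (incr s (fun x => h (v x)) p)).pow 2
          simp only [incr, sub_self, ne_eq, OfNat.ofNat_ne_zero, not_false_eq_true, zero_pow] at this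
          exact this
        have hz : Tendsto (fun n => min (A n p) (D p)) atTop (𝓝 0) :=
          squeeze_zero (fun n => le_min (by simp only [hA]; positivity)
            (by simp only [hD]; positivity)) (fun n => min_le_left _ _) hA0
        have := (ENNReal.continuous_ofReal.tendsto 0).comp hz
        rwa [ENNReal.ofReal_zero] at this
    refine tendsto_of_tendsto_of_tendsto_of_le_of_le tendsto_const_nhds
      (h := fun n => ENNReal.ofReal (4 * K ^ 2) * (∫⁻ p, ENNReal.ofReal (B n p))
        + ∫⁻ p, ENNReal.ofReal (min (A n p) (D p))) ?_ (fun _ => zero_le) (fun n => ?_)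
    · have := (ENNReal.Tendsto.const_mul (a := ENNReal.ofReal (4 * K ^ 2)) H.tendsto
        (Or.inr ENNReal.ofReal_ne_top)).add hmin
      simpa using this
    · calc ∫⁻ p, ENNReal.ofReal (A n p) ≤ _ := lintegral_mono (hle n)
        _ = _ := by
          rw [lintegral_add_right _ ((hmA n).min hDm).ennreal_ofReal,
            lintegral_const_mul' _ _ ENNReal.ofReal_ne_top]
  · filter_upwards [H.ae_tendsto] with x hx
    exact (hh.continuous.tendsto _).comp hx

/-- The weak formulation, tested with a smooth function of the solution. -/
lemma Approx.weak_formulation (hs0 : 0 < s) (hs1 : s < 1) (H : Approx s φ v) {M : ℝ}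
    (hM : ∀ x, |v x| ≤ M) {f : E d → ℝ} (hf : Integrable f)
    (hvf : ∀ ψ, IsTest ψ → ∫ x, v x * fracLap s ψ x = ∫ x, f x * ψ x)
    {h : ℝ → ℝ} (hh : ContDiff ℝ ∞ h) (h0 : h 0 = 0) {K : NNReal} (hK : LipschitzWith K h)
    {B : ℝ} (hB : ∀ t, |h t| ≤ B) :
    fracConst d s / 2 * ∫ p, incr s v p * incr s (fun x => h (v x)) p = ∫ x, f x * h (v x) := by
  have Hh := H.comp hs0 hs1 hh h0 hK
  have l1 := (tendsto_integral_mul_of_tendsto_sq (Hh.memLp hs0 hs1) (H.memLp hs0 hs1)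
    (fun n => (Hh.isTest n).memLp_incr hs0 hs1) Hh.tendsto).const_mul (fracConst d s / 2)
  have l2 : Tendsto (fun n => ∫ x, f x * h (φ n x)) atTop (𝓝 (∫ x, f x * h (v x))) := by
    refine tendsto_integral_of_dominated_convergence (fun x => |f x| * B)
      (fun n => hf.aestronglyMeasurable.mul (Hh.isTest n).measurable.aestronglyMeasurable)
      (hf.abs.mul_const B) (fun n => Eventually.of_forall fun x => ?_) ?_
    · rw [norm_mul, Real.norm_eq_abs, Real.norm_eq_abs]
      exact mul_le_mul_of_nonneg_left (hB _) (abs_nonneg _)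
    · filter_upwards [Hh.ae_tendsto] with x hx using hx.const_mul _
  refine tendsto_nhds_unique l1 (l2.congr fun n => ?_)
  rw [← hvf _ (Hh.isTest n), (Hh.isTest n).integral_mul_fracLap hs0 hs1 H.measurable hM
    (H.memLp hs0 hs1)]

end FracLap
end

/-! ### Fourier side: the energy as a multiplier and the half-order bound. -/

noncomputable section

namespace FracLap

open scoped FourierTransform ComplexConjugate

variable {d : ℕ}

/-- The Fourier transform of a real function. -/
def fhat (φ : E d → ℝ) : E d → ℂ := 𝓕 fun x => (φ x : ℂ)

/-- The real part of the cross spectrum of two real functions. -/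
def cross (u φ : E d → ℝ) (ξ : E d) : ℝ := (conj (fhat u ξ) * fhat φ ξ).re

lemma IsTest.exists_schwartz {φ : E d → ℝ} (hφ : IsTest φ) :
    ∃ f : SchwartzMap (E d) ℂ, (∀ x, f x = (φ x : ℂ)) ∧ ∀ ξ, 𝓕 f ξ = fhat φ ξ := by
  have h1 : HasCompactSupport fun x => (φ x : ℂ) := hφ.2.comp_left Complex.ofReal_zero
  have h2 : ContDiff ℝ ∞ fun x => (φ x : ℂ) := Complex.ofRealCLM.contDiff.comp hφ.1
  exact ⟨h1.toSchwartzMap h2, fun _ => rfl, fun _ => rfl⟩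

lemma IsTest.continuous_fhat {φ : E d → ℝ} (hφ : IsTest φ) : Continuous (fhat φ) := by
  obtain ⟨f, -, h⟩ := hφ.exists_schwartz
  exact (𝓕 f).continuous.congr h

lemma IsTest.memLp_fhat {φ : E d → ℝ} (hφ : IsTest φ) : MemLp (fun ξ => ‖fhat φ ξ‖) 2 := by
  obtain ⟨f, -, h⟩ := hφ.exists_schwartz
  refine ((𝓕 f).memLp 2 volume).norm.ae_eq (Eventually.of_forall fun ξ => ?_)
  simp only [h]

lemma abs_cross_le (u φ : E d → ℝ) (ξ : E d) : |cross u φ ξ| ≤ ‖fhat u ξ‖ * ‖fhat φ ξ‖ := by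
  refine (Complex.abs_re_le_norm _).trans ?_
  simp

lemma cross_self (u : E d → ℝ) (ξ : E d) : cross u u ξ = ‖fhat u ξ‖ ^ 2 := by
  rw [cross, mul_comm, Complex.mul_conj, Complex.ofReal_re, Complex.normSq_eq_norm_sq]

lemma integrable_cross {u φ : E d → ℝ} (hu : IsTest u) (hφ : IsTest φ) :
    Integrable (cross u φ) := by
  have h1 : Continuous (cross u φ) := by
    have := hu.continuous_fhat
    have := hφ.continuous_fhat
    unfold cross
    fun_prop
  exact (hu.memLp_fhat.integrable_mul hφ.memLp_fhat).mono' h1.aestronglyMeasurable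
    (Eventually.of_forall fun ξ => abs_cross_le u φ ξ)

lemma integral_cross {u φ : E d → ℝ} (hu : IsTest u) (hφ : IsTest φ) :
    ∫ ξ, cross u φ ξ = ∫ x, u x * φ x := by
  obtain ⟨f, hf, hf'⟩ := hu.exists_schwartz
  obtain ⟨g, hg, hg'⟩ := hφ.exists_schwartz
  have h := SchwartzMap.integral_inner_fourier_fourier f g
  simp only [hf, hg, hf', hg'] at h
  have hI : Integrable fun ξ => inner ℂ (fhat u ξ) (fhat φ ξ) := by
    have := hu.continuous_fhat
    have := hφ.continuous_fhat
    refine (hu.memLp_fhat.integrable_mul hφ.memLp_fhat).mono'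
      (Continuous.aestronglyMeasurable (by fun_prop)) (Eventually.of_forall fun ξ => ?_)
    exact norm_inner_le_norm _ _
  have h2 : ∀ x, inner ℂ (u x : ℂ) (φ x : ℂ) = ((u x * φ x : ℝ) : ℂ) := fun x => by
    simp [mul_comm]
  simp only [h2] at h
  rw [integral_complex_ofReal] at h
  have h3 := congrArg Complex.re h
  rw [Complex.ofReal_re] at h3
  rw [← h3, ← Complex.reCLM_apply, ← Complex.reCLM.integral_comp_comm hI]
  refine integral_congr_ae (Eventually.of_forall fun ξ => ?_)
  simp [cross, mul_comm]

lemma IsTest.fhat_difference {φ : E d → ℝ} (hφ : IsTest φ) (z ξ : E d) :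
    fhat (fun x => φ (x + z) - φ x) ξ
      = ((Real.fourierChar (inner ℝ z ξ) : ℂ) - 1) * fhat φ ξ := by
  have h1 : 𝓕 (fun x => (φ (x + z) : ℂ)) ξ = (Real.fourierChar (inner ℝ z ξ) : ℂ) * fhat φ ξ :=
    congrFun (VectorFourier.fourierIntegral_comp_add_right Real.fourierChar volume (innerₗ (E d))
      (fun x => (φ x : ℂ)) z) ξ
  rw [sub_mul, one_mul, ← h1]
  simp only [fhat, Real.fourier_eq]
  rw [← integral_sub ((Real.fourierIntegral_convergent_iff ξ).2 (hφ.translate z).integrable.ofReal)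
    ((Real.fourierIntegral_convergent_iff ξ).2 hφ.integrable.ofReal)]
  simp only [Complex.ofReal_sub, smul_sub]

/-- A difference by `z` multiplies the transform by `e^(2πi z·ξ) - 1`, whose squared modulus is `2(1
- cos(2π ξ·z))`. -/
lemma cross_difference {u φ : E d → ℝ} (hu : IsTest u) (hφ : IsTest φ) (z ξ : E d) :
    cross (fun x => u (x + z) - u x) (fun x => φ (x + z) - φ x) ξ
      = 2 * (1 - Real.cos (inner ℝ ((2 * Real.pi) • ξ) z)) * cross u φ ξ := by
  rw [cross, hu.fhat_difference, hφ.fhat_difference]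
  have h1 : ∀ a b c : ℂ, (conj (a * b) * (a * c)).re = ‖a‖ ^ 2 * (conj b * c).re := fun a b c => by
    rw [map_mul, mul_mul_mul_comm, mul_comm (conj a) a, Complex.mul_conj,
      Complex.re_ofReal_mul, Complex.normSq_eq_norm_sq]
  rw [h1, ← cross]
  congr 1
  rw [Real.fourierChar_apply, ← Complex.normSq_eq_norm_sq, Complex.normSq_apply, real_inner_smul_left,
    real_inner_comm]
  simp only [Complex.sub_re, Complex.sub_im, Complex.one_re, Complex.one_im,
    Complex.exp_ofReal_mul_I_re, Complex.exp_ofReal_mul_I_im]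
  have := Real.sin_sq_add_cos_sq (2 * Real.pi * inner ℝ ξ z)
  linear_combination this

variable {s : ℝ} {u φ : E d → ℝ}

lemma integral_incr_slice (hu : IsTest u) (hφ : IsTest φ) (z : E d) :
    ∫ x, incr s u (x, z) * incr s φ (x, z)
      = ∫ ξ, 2 * (1 - Real.cos (inner ℝ ((2 * Real.pi) • ξ) z)) * cross u φ ξ * kern s z := by
  simp only [incr_mul_incr, ← cross_difference hu hφ]
  rw [integral_mul_const, integral_mul_const,
    integral_cross ((hu.translate z).sub hu) ((hφ.translate z).sub hφ)]

/-- The bilinear form in Fourier variables, before integration in `z`. -/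
def specDensity (s : ℝ) (u φ : E d → ℝ) (p : E d × E d) : ℝ :=
  2 * (1 - Real.cos (inner ℝ ((2 * Real.pi) • p.1) p.2)) * cross u φ p.1 * kern s p.2

lemma measurable_specDensity (hu : IsTest u) (hφ : IsTest φ) : Measurable (specDensity s u φ) := by
  have := measurable_kern (d := d) s
  have := hu.continuous_fhat.measurable
  have := hφ.continuous_fhat.measurable
  unfold specDensity cross
  fun_prop

lemma one_sub_cos_nonneg (t : ℝ) : 0 ≤ 1 - Real.cos t := by linarith [Real.cos_le_one t]

variable [NeZero d]

/-- The diagonal density is nonnegative, so its slice integrals, known from Plancherel at fixed `z`,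
decide joint integrability. The mixed case follows by domination, and Fubini may then integrate in
`z` first to produce the symbol. -/
lemma integrable_specDensity_self (hs0 : 0 < s) (hs1 : s < 1) (hu : IsTest u) :
    Integrable (specDensity s u u) := by
  have hm := measurable_specDensity (s := s) hu hu
  refine (integrable_prod_iff' hm.aestronglyMeasurable).2 ⟨Eventually.of_forall fun z => ?_, ?_⟩
  · have := (integrable_cross ((hu.translate z).sub hu) ((hu.translate z).sub hu)).mul_const (kern s z)
    simp only [cross_difference hu hu] at this
    exact this
  · refine (hu.memLp_incr hs0 hs1).integrable_sq.integral_prod_right.congr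
      (Eventually.of_forall fun z => ?_)
    simp only [sq]
    rw [integral_incr_slice hu hu]
    refine integral_congr_ae (Eventually.of_forall fun ξ => ?_)
    have h0 : 0 ≤ specDensity s u u (ξ, z) :=
      mul_nonneg (mul_nonneg (mul_nonneg zero_le_two (one_sub_cos_nonneg _))
        (by rw [cross_self]; positivity)) (kern_nonneg _ _)
    simp only [Real.norm_of_nonneg h0]
    rfl

lemma integrable_specDensity (hs0 : 0 < s) (hs1 : s < 1) (hu : IsTest u) (hφ : IsTest φ) :
    Integrable (specDensity s u φ) := by
  refine ((integrable_specDensity_self hs0 hs1 hu).add (integrable_specDensity_self hs0 hs1 hφ)).mono'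
    (measurable_specDensity hu hφ).aestronglyMeasurable (Eventually.of_forall fun p => ?_)
  have h0 := one_sub_cos_nonneg (inner ℝ ((2 * Real.pi) • p.1) p.2)
  have hk := kern_nonneg s p.2
  simp only [specDensity, Pi.add_apply, cross_self]
  rw [norm_mul, norm_mul, Real.norm_of_nonneg hk, Real.norm_of_nonneg (mul_nonneg zero_le_two h0),
    ← add_mul, ← mul_add, Real.norm_eq_abs]
  gcongr
  nlinarith [abs_cross_le u φ p.1, sq_nonneg (‖fhat u p.1‖ - ‖fhat φ p.1‖),
    sq_nonneg (‖fhat u p.1‖), sq_nonneg (‖fhat φ p.1‖)]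

lemma integral_specDensity_slice (hs0 : 0 < s) (hs1 : s < 1) (ξ : E d) :
    fracConst d s / 2 * ∫ z, specDensity s u φ (ξ, z)
      = ‖(2 * Real.pi) • ξ‖ ^ (2 * s) * cross u φ ξ := by
  rw [← integral_one_sub_cos_mul_kern hs0 hs1]
  have : ∀ z, specDensity s u φ (ξ, z) = 2 * cross u φ ξ *
      ((1 - Real.cos (inner ℝ ((2 * Real.pi) • ξ) z)) * kern s z) := fun z => by
    simp only [specDensity]; ring
  simp only [this]
  rw [integral_const_mul]
  ring

lemma integrable_symbol_mul_cross (hs0 : 0 < s) (hs1 : s < 1) (hu : IsTest u) (hφ : IsTest φ) :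
    Integrable fun ξ => ‖(2 * Real.pi) • ξ‖ ^ (2 * s) * cross u φ ξ := by
  simp only [← integral_specDensity_slice hs0 hs1]
  exact (integrable_specDensity hs0 hs1 hu hφ).integral_prod_left.const_mul _

lemma form_eq_integral_symbol (hs0 : 0 < s) (hs1 : s < 1) (hu : IsTest u) (hφ : IsTest φ) :
    fracConst d s / 2 * ∫ p, incr s u p * incr s φ p
      = ∫ ξ, ‖(2 * Real.pi) • ξ‖ ^ (2 * s) * cross u φ ξ := by
  have hI : Integrable fun p => incr s u p * incr s φ p :=
    (hu.memLp_incr hs0 hs1).integrable_mul (hφ.memLp_incr hs0 hs1)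
  have hJ := integrable_specDensity hs0 hs1 hu hφ
  simp only [← integral_specDensity_slice hs0 hs1]
  rw [integral_const_mul, Measure.volume_eq_prod, integral_prod_symm _ hI,
    ← integral_prod _ hJ, integral_prod_symm _ hJ]
  simp only [integral_incr_slice hu hφ]
  rfl

/-- The half-order fractional Laplacian is bounded from the homogeneous space to `L²`. -/
lemma sq_integral_mul_fracLap_half_le (hs0 : 0 < s) (hs1 : s < 1) (hu : IsTest u) (hφ : IsTest φ) :
    (∫ x, u x * fracLap (s / 2) φ x) ^ 2
      ≤ (fracConst d s / 2 * ∫ p, incr s u p ^ 2) * ∫ x, φ x ^ 2 := by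
  obtain ⟨M, -, hM⟩ := hu.exists_bound
  have h0 : 0 < s / 2 := by linarith
  have h1 : s / 2 < 1 := by linarith
  rw [hφ.integral_mul_fracLap h0 h1 hu.measurable hM (hu.memLp_incr h0 h1),
    form_eq_integral_symbol h0 h1 hu hφ]
  -- The symbol of order `s / 2` is `|2πξ|^s`; its square is the symbol of order `s`, so
  -- Cauchy–Schwarz in `ξ` produces exactly the `s`-energy.
  have e1 : fracConst d s / 2 * ∫ p, incr s u p ^ 2
      = ∫ ξ, (‖(2 * Real.pi) • ξ‖ ^ s * ‖fhat u ξ‖) ^ 2 := by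
    simp only [sq (incr s u _)]
    rw [form_eq_integral_symbol hs0 hs1 hu hu]
    refine integral_congr_ae (Eventually.of_forall fun ξ => ?_)
    simp only [cross_self]
    rw [mul_pow, ← Real.rpow_mul_natCast (norm_nonneg _)]
    norm_num [mul_comm]
  have e2 : ∫ x, φ x ^ 2 = ∫ ξ, ‖fhat φ ξ‖ ^ 2 := by
    simp only [sq (φ _)]
    rw [← integral_cross hφ hφ]
    simp only [cross_self]
  have hF : MemLp (fun ξ => ‖(2 * Real.pi) • ξ‖ ^ s * ‖fhat u ξ‖) 2 := by
    have hc := hu.continuous_fhat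
    refine (memLp_two_iff_integrable_sq (Measurable.aestronglyMeasurable ?_)).2 ?_
    · have := hc.measurable
      fun_prop
    · refine (integrable_symbol_mul_cross hs0 hs1 hu hu).congr (Eventually.of_forall fun ξ => ?_)
      simp only [cross_self]
      rw [mul_pow, ← Real.rpow_mul_natCast (norm_nonneg _)]
      norm_num [mul_comm]
  rw [e1, e2]
  refine le_trans ?_ (sq_integral_mul_le hF hφ.memLp_fhat)
  rw [← sq_abs]
  refine pow_le_pow_left₀ (abs_nonneg _) ((abs_integral_le_integral_abs).trans ?_) 2
  refine integral_mono (integrable_symbol_mul_cross h0 h1 hu hφ).abs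
    (hF.integrable_mul hφ.memLp_fhat) fun ξ => ?_
  have : (2 * (s / 2)) = s := by ring
  simp only [this, abs_mul]
  rw [abs_of_nonneg (by positivity), mul_assoc]
  exact mul_le_mul_of_nonneg_left (abs_cross_le u φ ξ) (by positivity)

/-- The same bound for bounded limits of test functions. -/
lemma Approx.sq_integral_mul_fracLap_half_le {ψ : ℕ → E d → ℝ} {v : E d → ℝ} (hs0 : 0 < s)
    (hs1 : s < 1) (H : Approx s ψ v) {B : ℝ} (hB : ∀ n x, |ψ n x| ≤ B) (hφ : IsTest φ) :
    (∫ x, v x * fracLap (s / 2) φ x) ^ 2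
      ≤ (fracConst d s / 2 * ∫ p, incr s v p ^ 2) * ∫ x, φ x ^ 2 := by
  have hL := hφ.integrable_fracLap (s := s / 2) (by linarith) (by linarith)
  have l1 : Tendsto (fun n => ∫ x, ψ n x * fracLap (s / 2) φ x) atTop
      (𝓝 (∫ x, v x * fracLap (s / 2) φ x)) := by
    refine tendsto_integral_of_dominated_convergence (fun x => B * |fracLap (s / 2) φ x|)
      (fun n => (H.isTest n).measurable.aestronglyMeasurable.mul hL.aestronglyMeasurable)
      (hL.abs.const_mul B) (fun n => Eventually.of_forall fun x => ?_) ?_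
    · rw [norm_mul, Real.norm_eq_abs, Real.norm_eq_abs]
      exact mul_le_mul_of_nonneg_right (hB n x) (abs_nonneg _)
    · filter_upwards [H.ae_tendsto] with x hx using hx.mul_const _
  have l2 := ((tendsto_integral_sq_of_tendsto_sq (H.memLp hs0 hs1)
    (fun n => (H.isTest n).memLp_incr hs0 hs1) H.tendsto).const_mul (fracConst d s / 2)).mul_const
    (∫ x, φ x ^ 2)
  exact le_of_tendsto_of_tendsto' (l1.pow 2) l2 fun n =>
    FracLap.sq_integral_mul_fracLap_half_le hs0 hs1 (H.isTest n) hφ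

end FracLap
end

/-! ### The pointwise inequality, shifted powers and Riesz representation. -/

noncomputable section

namespace FracLap

/-- The pointwise Stroock–Varopoulos inequality. -/
lemma stroock_varopoulos {q a b : ℝ} (hq : 1 < q) (ha : 0 < a) (hb : 0 < b) :
    4 * (q - 1) / q ^ 2 * (a ^ (q / 2) - b ^ (q / 2)) ^ 2
      ≤ (a - b) * (a ^ (q - 1) - b ^ (q - 1)) := by
  wlog hab : b < a generalizing a b
  · rcases (not_lt.1 hab).eq_or_lt with h | h
    · simp [h]
    · have := this hb ha h
      linarith
  -- `l` is the mean of `t^(q/2-1)` over `[b, a]`, and `F` is a primitive of `(l - t^(q/2-1))²`.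
  -- Thus `F b ≤ F a` is Cauchy–Schwarz for that mean.
  set l := 2 / q * (a ^ (q / 2) - b ^ (q / 2)) / (a - b) with hl
  set F : ℝ → ℝ := fun t => l ^ 2 * t - 2 * l * (2 / q * t ^ (q / 2)) + t ^ (q - 1) / (q - 1) with hF
  have hq1 : 0 < q - 1 := by linarith
  have hder : ∀ t, 0 < t → HasDerivAt F ((l - t ^ (q / 2 - 1)) ^ 2) t := by
    intro t ht
    have h1 := (Real.hasDerivAt_rpow_const (x := t) (p := q / 2) (Or.inl ht.ne')).const_mul (2 / q)
    have h2 := (Real.hasDerivAt_rpow_const (x := t) (p := q - 1) (Or.inl ht.ne')).div_const (q - 1)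
    have h3 := (((hasDerivAt_id t).const_mul (l ^ 2)).sub (h1.const_mul (2 * l))).add h2
    refine h3.congr_deriv ?_
    have e : t ^ (q - 1 - 1) = (t ^ (q / 2 - 1)) ^ 2 := by
      rw [← Real.rpow_mul_natCast ht.le]; congr 1; push_cast; ring
    rw [e]
    field_simp
    ring
  have hmono : MonotoneOn F (Set.Ioi 0) := by
    refine monotoneOn_of_deriv_nonneg (convex_Ioi 0)
      (fun t ht => (hder t ht).continuousAt.continuousWithinAt) ?_ ?_
    · rw [interior_Ioi]
      exact fun t ht => (hder t ht).differentiableAt.differentiableWithinAt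
    · rw [interior_Ioi]
      intro t ht
      rw [(hder t ht).deriv]
      positivity
  have hFab := hmono hb ha hab.le
  have hab' : 0 < a - b := by linarith
  have hm : l * (a - b) = 2 / q * (a ^ (q / 2) - b ^ (q / 2)) := by
    rw [hl]; field_simp
  simp only [hF] at hFab
  have h4 : l ^ 2 * (a - b) ≤ (a ^ (q - 1) - b ^ (q - 1)) / (q - 1) := by
    have e1 : 2 * l * (2 / q * a ^ (q / 2)) - 2 * l * (2 / q * b ^ (q / 2)) = 2 * (l * (l * (a - b))) := by
      rw [hm]; ring
    rw [sub_div]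
    nlinarith
  rw [le_div_iff₀ hq1] at h4
  calc 4 * (q - 1) / q ^ 2 * (a ^ (q / 2) - b ^ (q / 2)) ^ 2
      = (q - 1) * (2 / q * (a ^ (q / 2) - b ^ (q / 2))) ^ 2 := by ring
    _ = (a - b) * (l ^ 2 * (a - b) * (q - 1)) := by rw [← hm]; ring
    _ ≤ _ := mul_le_mul_of_nonneg_left h4 hab'.le

/-- A shifted power, extended from `[0, M]` to a smooth compactly supported function. -/
lemma exists_smooth_shifted_rpow (p : ℝ) {δ M : ℝ} (hδ : 0 < δ) (hM : 0 ≤ M) :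
    ∃ h : ℝ → ℝ, ContDiff ℝ ∞ h ∧ HasCompactSupport h ∧ h 0 = 0 ∧
      ∀ t, 0 ≤ t → t ≤ M → h t = (t + δ) ^ p - δ ^ p := by
  -- The support `[-δ/2, M + δ/2]` avoids the singularity at `-δ`. The margin `δ / 4` keeps the
  -- inner radius positive even if `M = 0`.
  let χ : ContDiffBump (M / 2) :=
    { rIn := M / 2 + δ / 4, rOut := M / 2 + δ / 2, rIn_pos := by linarith, rIn_lt_rOut := by linarith }
  have hχ1 : ∀ t, 0 ≤ t → t ≤ M → χ t = 1 := fun t h0 h1 => by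
    refine χ.one_of_mem_closedBall ?_
    rw [Metric.mem_closedBall, Real.dist_eq, abs_le]
    constructor <;> simp only [χ] <;> linarith
  refine ⟨fun t => χ t * ((t + δ) ^ p - δ ^ p), ?_, χ.hasCompactSupport.mul_right, by simp,
    fun t h0 h1 => by simp [hχ1 t h0 h1]⟩
  rw [contDiff_iff_contDiffAt]
  intro t
  by_cases ht : 0 < t + δ
  · exact χ.contDiff.contDiffAt.mul
      (((contDiffAt_id.add contDiffAt_const).rpow_const_of_ne ht.ne').sub contDiffAt_const)
  · have hnt : t ∉ tsupport χ := by
      rw [χ.tsupport_eq, Metric.mem_closedBall, Real.dist_eq, abs_le, not_and_or]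
      left
      simp only [χ]
      linarith
    have hev : (fun t => χ t * ((t + δ) ^ p - δ ^ p)) =ᶠ[𝓝 t] fun _ => 0 := by
      filter_upwards [(isClosed_tsupport χ).isOpen_compl.mem_nhds hnt] with y hy
      rw [image_eq_zero_of_notMem_tsupport hy, zero_mul]
    exact contDiffAt_const.congr_of_eventuallyEq hev

section Riesz

/-- A linear functional that is bounded by a Hilbert seminorm is represented by a vector. -/
lemma exists_inner_representation {V H : Type*} [AddCommGroup V] [Module ℝ V]
    [NormedAddCommGroup H] [InnerProductSpace ℝ H] [CompleteSpace H]
    (J : V →ₗ[ℝ] H) (T : V →ₗ[ℝ] ℝ) {A : ℝ} (hA : 0 ≤ A) (h : ∀ x, T x ^ 2 ≤ A * ‖J x‖ ^ 2) :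
    ∃ g : H, ‖g‖ ^ 2 ≤ A ∧ ∀ x, T x = inner ℝ g (J x) := by
  -- The bound makes `T` vanish on `ker J`, so `T` descends to the range of `J` through any linear
  -- section. Hahn–Banach extends it with the same norm.
  obtain ⟨σ, hσ⟩ := J.rangeRestrict.exists_rightInverse_of_surjective J.range_rangeRestrict
  have hJσ : ∀ y, J (σ y) = y := fun y => congrArg Subtype.val (LinearMap.congr_fun hσ y)
  have hb : ∀ y, ‖(T ∘ₗ σ) y‖ ≤ √A * ‖y‖ := fun y => by
    have h1 := h (σ y)
    rw [hJσ] at h1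
    rw [LinearMap.comp_apply, Real.norm_eq_abs, ← Real.sqrt_sq_eq_abs]
    refine (Real.sqrt_le_sqrt h1).trans_eq ?_
    rw [Real.sqrt_mul hA, Real.sqrt_sq (norm_nonneg _)]
    rfl
  obtain ⟨L, hL, hLn⟩ := exists_extension_norm_eq _ ((T ∘ₗ σ).mkContinuous (√A) hb)
  refine ⟨(InnerProductSpace.toDual ℝ H).symm L, ?_, fun x => ?_⟩
  · rw [LinearIsometryEquiv.norm_map, hLn]
    have := LinearMap.mkContinuous_norm_le (T ∘ₗ σ) (Real.sqrt_nonneg A) hb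
    calc _ ≤ √A ^ 2 := pow_le_pow_left₀ (norm_nonneg _) this 2
      _ = A := Real.sq_sqrt hA
  · rw [InnerProductSpace.toDual_symm_apply]
    have h1 := hL (J.rangeRestrict x)
    have h2 : T (x - σ (J.rangeRestrict x)) = 0 := by
      have h3 := h (x - σ (J.rangeRestrict x))
      rw [map_sub J, hJσ] at h3
      change _ ≤ A * ‖J x - J x‖ ^ 2 at h3
      rw [sub_self, norm_zero] at h3
      exact pow_eq_zero_iff two_ne_zero |>.1 (le_antisymm (by simpa using h3) (sq_nonneg _))
    rw [map_sub, sub_eq_zero] at h2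
    rw [h2]
    exact h1.symm

end Riesz

variable {d : ℕ}

/-- The space of test functions. -/
def testSubmodule (d : ℕ) : Submodule ℝ (E d → ℝ) where
  carrier := {φ | IsTest φ}
  add_mem' hφ hψ := ⟨hφ.1.add hψ.1, hφ.2.add hψ.2⟩
  zero_mem' := ⟨contDiff_const, HasCompactSupport.zero⟩
  smul_mem' _ _ hφ := ⟨contDiff_const.smul hφ.1, hφ.2.smul_left⟩

lemma IsTest.memLp {φ : E d → ℝ} (hφ : IsTest φ) : MemLp φ 2 :=
  hφ.continuous.memLp_of_hasCompactSupport hφ.2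

/-- The inclusion of test functions into `L²`. -/
def testToL2 (d : ℕ) : testSubmodule d →ₗ[ℝ] Lp ℝ 2 (volume : Measure (E d)) where
  toFun φ := MemLp.toLp φ.1 (IsTest.memLp φ.2)
  map_add' _ _ := rfl
  map_smul' _ _ := rfl

variable [NeZero d] {s : ℝ}

/-- The pairing of a bounded function with the fractional Laplacian of test functions. -/
def fracLapPairing (hs0 : 0 < s) (hs1 : s < 1) {u : E d → ℝ} (hu : Measurable u) {M : ℝ}
    (hM : ∀ x, |u x| ≤ M) : testSubmodule d →ₗ[ℝ] ℝ where
  toFun φ := ∫ x, u x * fracLap s φ.1 x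
  map_add' φ ψ := by
    have hφ : IsTest φ.1 := φ.2
    have hψ : IsTest ψ.1 := ψ.2
    -- Linearity is read off from the second-difference integral, since `fracLap` is defined by a
    -- limit.
    rw [IsTest.integral_mul_fracLap_eq hs0 hs1 (φ + ψ).2 hu hM,
      hφ.integral_mul_fracLap_eq hs0 hs1 hu hM, hψ.integral_mul_fracLap_eq hs0 hs1 hu hM, ← mul_add,
      ← integral_add (hφ.integrable_mul_secDiff hs0 hs1 hu hM)
        (hψ.integrable_mul_secDiff hs0 hs1 hu hM)]
    congr 1
    refine integral_congr_ae (Eventually.of_forall fun p => ?_)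
    simp only [secDiff, Submodule.coe_add, Pi.add_apply]
    ring
  map_smul' c φ := by
    have hφ : IsTest φ.1 := φ.2
    rw [IsTest.integral_mul_fracLap_eq hs0 hs1 (c • φ).2 hu hM,
      hφ.integral_mul_fracLap_eq hs0 hs1 hu hM, RingHom.id_apply, smul_eq_mul, mul_left_comm,
      ← integral_const_mul c]
    congr 1
    refine integral_congr_ae (Eventually.of_forall fun p => ?_)
    simp only [secDiff, Submodule.coe_smul, Pi.smul_apply, smul_eq_mul]
    ring

omit [NeZero d] in
lemma integral_mul_eq_inner {F G : E d → ℝ} (g : Lp ℝ 2 (volume : Measure (E d)))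
    (hF : F =ᵐ[volume] g) (hG : MemLp G 2) : inner ℝ g (hG.toLp G) = ∫ x, F x * G x := by
  rw [L2.inner_def]
  refine integral_congr_ae ?_
  filter_upwards [hF, hG.coeFn_toLp] with x h1 h2
  rw [h2, h1]
  simp [mul_comm]

/-- A bounded function whose pairings are `L²`-bounded has an `L²` fractional Laplacian. -/
lemma exists_hasFracLap (hs0 : 0 < s) (hs1 : s < 1) {u : E d → ℝ} (hu : Measurable u) {M : ℝ}
    (hM : ∀ x, |u x| ≤ M) {A : ℝ} (hA : 0 ≤ A)
    (h : ∀ φ, IsTest φ → (∫ x, u x * fracLap s φ x) ^ 2 ≤ A * ∫ x, φ x ^ 2) :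
    ∃ g : E d → ℝ, MemLp g 2 ∧ HasFracLap s u g ∧ ∫ x, |g x| ^ 2 ≤ A := by
  obtain ⟨g, hg, hgT⟩ := exists_inner_representation (testToL2 d) (fracLapPairing hs0 hs1 hu hM) hA
    (fun φ => by
      have hφ : IsTest φ.1 := φ.2
      have e : ‖testToL2 d φ‖ ^ 2 = ∫ x, φ.1 x ^ 2 := by
        rw [← real_inner_self_eq_norm_sq]
        simp only [sq]
        exact integral_mul_eq_inner _ hφ.memLp.coeFn_toLp.symm hφ.memLp
      rw [e]
      exact h φ.1 hφ)
  have hgm : MemLp g 2 := Lp.memLp g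
  refine ⟨g, hgm, ⟨hgm.locallyIntegrable one_le_two, fun φ hφ =>
    ⟨hφ.integrable_mul_fracLap hs0 hs1 hu hM, ?_⟩⟩, ?_⟩
  · exact (hgT ⟨φ, hφ⟩).trans (integral_mul_eq_inner g (ae_eq_refl _) hφ.memLp)
  · refine le_trans (le_of_eq ?_) hg
    rw [← real_inner_self_eq_norm_sq]
    nth_rewrite 3 [← Lp.toLp_coeFn g hgm]
    rw [integral_mul_eq_inner g (ae_eq_refl _) hgm]
    simp only [sq_abs]
    simp only [sq]

/-- Boundedness of shifted powers on bounded ranges. -/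
lemma abs_shifted_rpow_le {p t δ M : ℝ} (hp : 0 ≤ p) (hδ : 0 ≤ δ) (hδ1 : δ ≤ 1) (ht : 0 ≤ t)
    (htM : t ≤ M) : |(t + δ) ^ p - δ ^ p| ≤ (M + 1) ^ p := by
  have h1 : δ ^ p ≤ (t + δ) ^ p := Real.rpow_le_rpow hδ (by linarith) hp
  have h2 : (t + δ) ^ p ≤ (M + 1) ^ p := Real.rpow_le_rpow (by linarith) (by linarith) hp
  have h3 : 0 ≤ δ ^ p := Real.rpow_nonneg hδ p
  rw [abs_of_nonneg (by linarith)]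
  linarith

omit [NeZero d] in
-- Removes the shift on both sides of the estimate: with `F = f` and `p = q - 1`, and with `F =
-- (-Δ)^(s/2) ψ` and `p = q / 2`.
lemma tendsto_integral_shifted_rpow {v F : E d → ℝ} (hv : Measurable v) {M : ℝ}
    (h0 : ∀ x, 0 ≤ v x) (hM : ∀ x, v x ≤ M) (hF : Integrable F) {p : ℝ} (hp : 0 < p) :
    Tendsto (fun δ : ℝ => ∫ x, ((v x + δ) ^ p - δ ^ p) * F x) (𝓝[>] 0)
      (𝓝 (∫ x, v x ^ p * F x)) := by
  refine tendsto_integral_filter_of_dominated_convergence (fun x => (M + 1) ^ p * |F x|) ?_ ?_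
    (hF.abs.const_mul _) ?_
  · exact Eventually.of_forall fun δ =>
      (Measurable.aestronglyMeasurable (by fun_prop)).mul hF.aestronglyMeasurable
  · have h1 : ∀ᶠ δ : ℝ in 𝓝[>] 0, δ < 1 := nhdsWithin_le_nhds (gt_mem_nhds one_pos)
    filter_upwards [self_mem_nhdsWithin, h1] with δ hδ hδ1
    refine Eventually.of_forall fun x => ?_
    rw [norm_mul, Real.norm_eq_abs, Real.norm_eq_abs]
    exact mul_le_mul_of_nonneg_right
      (abs_shifted_rpow_le hp.le (le_of_lt hδ) hδ1.le (h0 x) (hM x)) (abs_nonneg _)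
  · refine Eventually.of_forall fun x => ?_
    have hc : Continuous fun δ : ℝ => ((v x + δ) ^ p - δ ^ p) * F x :=
      (((Real.continuous_rpow_const hp.le).comp (continuous_const.add continuous_id)).sub
        (Real.continuous_rpow_const hp.le)).mul continuous_const
    have := hc.tendsto 0
    rw [add_zero, Real.zero_rpow hp.ne', sub_zero] at this
    exact this.mono_left nhdsWithin_le_nhds

/-! ### Energy estimates for powers of the solution. -/

section Solution

variable {φ : ℕ → E d → ℝ} {v f : E d → ℝ} {M q : ℝ}

/-- The energy estimate for shifted powers of the solution. -/
lemma Approx.energy_shifted_rpow (hs0 : 0 < s) (hs1 : s < 1) (H : Approx s φ v)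
    (h0 : ∀ x, 0 ≤ v x) (hM : ∀ x, v x ≤ M) (hf : Integrable f)
    (hvf : ∀ ψ, IsTest ψ → ∫ x, v x * fracLap s ψ x = ∫ x, f x * ψ x) (hq : 1 < q)
    {δ : ℝ} (hδ : 0 < δ) :
    ∃ e, 0 ≤ e ∧ 4 * (q - 1) / q ^ 2 * e ≤ ∫ x, ((v x + δ) ^ (q - 1) - δ ^ (q - 1)) * f x ∧
      ∀ ψ, IsTest ψ → (∫ x, ((v x + δ) ^ (q / 2) - δ ^ (q / 2)) * fracLap (s / 2) ψ x) ^ 2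
        ≤ e * ∫ x, ψ x ^ 2 := by
  have hM0 : 0 ≤ M := (h0 0).trans (hM 0)
  have hC := fracConst_pos (d := d) hs0 hs1
  obtain ⟨h, hh, hhc, hh0, hhe⟩ := exists_smooth_shifted_rpow (q - 1) hδ hM0
  obtain ⟨k, hk, hkc, hk0, hke⟩ := exists_smooth_shifted_rpow (q / 2) hδ hM0
  obtain ⟨K, hK⟩ := hh.lipschitzWith_of_hasCompactSupport hhc (by simp)
  obtain ⟨K', hK'⟩ := hk.lipschitzWith_of_hasCompactSupport hkc (by simp)
  obtain ⟨B, hB⟩ := hhc.exists_bound_of_continuous hh.continuous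
  obtain ⟨B', hB'⟩ := hkc.exists_bound_of_continuous hk.continuous
  have Hh := H.comp hs0 hs1 hh hh0 hK
  have Hk := H.comp hs0 hs1 hk hk0 hK'
  have hhv : ∀ x, h (v x) = (v x + δ) ^ (q - 1) - δ ^ (q - 1) := fun x => hhe _ (h0 x) (hM x)
  have hkv : ∀ x, k (v x) = (v x + δ) ^ (q / 2) - δ ^ (q / 2) := fun x => hke _ (h0 x) (hM x)
  -- `e` is the `s`-energy of the shifted `q / 2` power.
  refine ⟨fracConst d s / 2 * ∫ p, incr s (fun x => k (v x)) p ^ 2,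
    mul_nonneg (by positivity) (integral_nonneg fun _ => sq_nonneg _), ?_, fun ψ hψ => ?_⟩
  · have hw := H.weak_formulation hs0 hs1 (M := M)
      (fun x => by rw [abs_of_nonneg (h0 x)]; exact hM x) hf hvf hh hh0 hK hB
    simp only [mul_comm _ (f _), ← hhv]
    rw [← hw, mul_left_comm, ← integral_const_mul]
    refine mul_le_mul_of_nonneg_left ?_ (by positivity)
    refine integral_mono ((Hk.memLp hs0 hs1).integrable_sq.const_mul _)
      ((H.memLp hs0 hs1).integrable_mul (Hh.memLp hs0 hs1)) fun p => ?_
    simp only [sq (incr s _ p), incr_mul_incr, hhv, hkv]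
    have hsv := stroock_varopoulos hq (add_pos_of_nonneg_of_pos (h0 (p.1 + p.2)) hδ)
      (add_pos_of_nonneg_of_pos (h0 p.1) hδ)
    have := mul_le_mul_of_nonneg_right hsv (kern_nonneg s p.2)
    convert this using 1 <;> ring
  · simp only [← hkv]
    exact Hk.sq_integral_mul_fracLap_half_le hs0 hs1 (fun n x => hB' _) hψ

/-- The energy `e` depends on `δ`. It is eliminated before the limit, so only pairings with fixed
integrable functions have to converge. -/
lemma Approx.energy_rpow (hs0 : 0 < s) (hs1 : s < 1) (H : Approx s φ v)
    (h0 : ∀ x, 0 ≤ v x) (hM : ∀ x, v x ≤ M) (hf : Integrable f)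
    (hvf : ∀ ψ, IsTest ψ → ∫ x, v x * fracLap s ψ x = ∫ x, f x * ψ x) (hq : 1 < q) :
    0 ≤ ∫ x, v x ^ (q - 1) * f x ∧
      ∀ ψ, IsTest ψ → 4 * (q - 1) / q ^ 2 * (∫ x, v x ^ (q / 2) * fracLap (s / 2) ψ x) ^ 2
        ≤ (∫ x, v x ^ (q - 1) * f x) * ∫ x, ψ x ^ 2 := by
  have hκ : 0 ≤ 4 * (q - 1) / q ^ 2 := div_nonneg (by linarith) (sq_nonneg _)
  have l1 := tendsto_integral_shifted_rpow H.measurable h0 hM hf (p := q - 1) (by linarith)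
  refine ⟨ge_of_tendsto l1 ?_, fun ψ hψ => ?_⟩
  · filter_upwards [self_mem_nhdsWithin] with δ hδ
    obtain ⟨e, he0, he, -⟩ := H.energy_shifted_rpow hs0 hs1 h0 hM hf hvf hq hδ
    exact (mul_nonneg hκ he0).trans he
  · have l2 := tendsto_integral_shifted_rpow H.measurable h0 hM
      (hψ.integrable_fracLap (s := s / 2) (by linarith) (by linarith)) (p := q / 2) (by linarith)
    refine le_of_tendsto_of_tendsto ((l2.pow 2).const_mul _) (l1.mul_const _) ?_
    filter_upwards [self_mem_nhdsWithin] with δ hδ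
    obtain ⟨e, he0, he, heψ⟩ := H.energy_shifted_rpow hs0 hs1 h0 hM hf hvf hq hδ
    calc _ ≤ 4 * (q - 1) / q ^ 2 * (e * ∫ x, ψ x ^ 2) := mul_le_mul_of_nonneg_left (heψ ψ hψ) hκ
      _ = (4 * (q - 1) / q ^ 2 * e) * ∫ x, ψ x ^ 2 := by ring
      _ ≤ _ := mul_le_mul_of_nonneg_right he (integral_nonneg fun _ => sq_nonneg _)

end Solution

/-! ### Change of representative and conclusion. -/

lemma hdotSq_congr {u w : E d → ℝ} (h : u =ᵐ[volume] w) : hdotSq s u = hdotSq s w := by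
  unfold hdotSq
  congr 1
  refine lintegral_congr_ae ?_
  filter_upwards [h] with x hx
  refine lintegral_congr_ae ?_
  filter_upwards [h] with y hy
  simp only [hx, hy]

lemma MemHdot.exists_approx (hs0 : 0 < s) (hs1 : s < 1) {v w : E d → ℝ} (hv : MemHdot s v)
    (hw : Measurable w) (hvw : v =ᵐ[volume] w) : ∃ φ, Approx s φ w := by
  obtain ⟨φ, hφ, ht, hae⟩ := hv
  have hC := fracConst_pos (d := d) hs0 hs1
  refine ⟨φ, hw, hφ, ?_, ?_⟩
  · have hc : ENNReal.ofReal (fracConst d s / 2) ≠ 0 := by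
      rw [ne_eq, ENNReal.ofReal_eq_zero, not_le]; positivity
    have := ENNReal.Tendsto.const_mul (a := (ENNReal.ofReal (fracConst d s / 2))⁻¹) ht
      (Or.inr (ENNReal.inv_ne_top.2 hc))
    rw [mul_zero] at this
    refine this.congr fun n => ?_
    have e : (fun x => φ n x - v x) =ᵐ[volume] fun x => φ n x - w x := by
      filter_upwards [hvw] with x hx
      rw [hx]
    have hm : Measurable fun x => φ n x - w x := (hφ n).measurable.sub hw
    rw [hdotSq_congr e, hdotSq_eq hm, ← mul_assoc,
      ENNReal.inv_mul_cancel hc ENNReal.ofReal_ne_top, one_mul]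
    simp only [incr_sub]
  · filter_upwards [hae, hvw] with x h1 h2
    rwa [h2] at h1

omit [NeZero d] in
lemma exists_bounded_representative {v : E d → ℝ} (h0 : ∀ᵐ x, 0 ≤ v x) (hv : MemLp v ⊤) :
    ∃ (w : E d → ℝ) (M : ℝ), Measurable w ∧ (∀ x, 0 ≤ w x) ∧ (∀ x, w x ≤ M) ∧ v =ᵐ[volume] w := by
  obtain ⟨M, hM0, hM⟩ : ∃ M : ℝ, 0 ≤ M ∧ ∀ᵐ x, |v x| ≤ M := by
    refine ⟨(eLpNorm v ⊤ volume).toReal, ENNReal.toReal_nonneg, ?_⟩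
    filter_upwards [ae_le_eLpNormEssSup (f := v) (μ := volume)] with x hx
    rw [← eLpNorm_exponent_top] at hx
    have := ENNReal.toReal_mono hv.2.ne hx
    simpa using this
  -- Truncating a measurable version to `[0, M]` makes the bounds hold everywhere, as the
  -- composition step needs.
  refine ⟨fun x => max 0 (min M (hv.1.mk v x)), M, ?_, fun x => le_max_left _ _,
    fun x => max_le hM0 (min_le_left _ _), ?_⟩
  · have := hv.1.stronglyMeasurable_mk.measurable
    fun_prop
  · filter_upwards [hv.1.ae_eq_mk, h0, hM] with x h1 h2 h3
    rw [← h1, min_eq_right ((le_abs_self _).trans h3), max_eq_right h2]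

lemma HasFracLap.congr_left {u w g : E d → ℝ} (h : HasFracLap s u g) (huw : u =ᵐ[volume] w) :
    HasFracLap s w g := by
  refine ⟨h.1, fun φ hφ => ?_⟩
  have e : (fun x => u x * fracLap s φ x) =ᵐ[volume] fun x => w x * fracLap s φ x := by
    filter_upwards [huw] with x hx
    rw [hx]
  exact ⟨(h.2 φ hφ).1.congr e, (integral_congr_ae e).symm.trans (h.2 φ hφ).2⟩

end FracLap

end

theorem lemma4p3 {d : ℕ} [NeZero d] {s : ℝ} (hs0 : 0 < s) (hs1 : s < 1)
    (hd : 2 * s < (d : ℝ))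
    (v : FracLap.E d → ℝ) (hv0 : ∀ᵐ x : FracLap.E d, 0 ≤ v x)
    (hvb : MemLp v ∞ (volume : Measure (FracLap.E d)))
    (hvH : FracLap.MemHdot s v)
    (f : FracLap.E d → ℝ) (hf : Integrable f (volume : Measure (FracLap.E d)))
    (hvf : FracLap.HasFracLap s v f)
    (q : ℝ) (hq : 1 < q) :
    Integrable (fun x => v x ^ (q - 1) * f x) (volume : Measure (FracLap.E d)) ∧
    ∃ g : FracLap.E d → ℝ, MemLp g 2 (volume : Measure (FracLap.E d)) ∧
      FracLap.HasFracLap (s / 2) (fun x => v x ^ (q / 2)) g ∧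
      4 * (q - 1) / q ^ 2 * ∫ x, |g x| ^ 2 ≤ ∫ x, v x ^ (q - 1) * f x := by
  obtain ⟨w, M, hw, hw0, hwM, hvw⟩ := FracLap.exists_bounded_representative hv0 hvb
  obtain ⟨φ, H⟩ := hvH.exists_approx hs0 hs1 hw hvw
  have hwf := hvf.congr_left hvw
  have hpow : ∀ p : ℝ, (fun x => w x ^ p) =ᵐ[volume] fun x => v x ^ p := fun p => by
    filter_upwards [hvw] with x hx
    rw [hx]
  have hbd : ∀ p : ℝ, 0 ≤ p → ∀ x, |w x ^ p| ≤ M ^ p := fun p hp x => by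
    rw [abs_of_nonneg (Real.rpow_nonneg (hw0 x) p)]
    exact Real.rpow_le_rpow (hw0 x) (hwM x) hp
  have hpf : (fun x => w x ^ (q - 1) * f x) =ᵐ[volume] fun x => v x ^ (q - 1) * f x := by
    filter_upwards [hvw] with x hx
    rw [hx]
  obtain ⟨hA, hE⟩ := H.energy_rpow hs0 hs1 hw0 hwM hf (fun ψ hψ => (hwf.2 ψ hψ).2) hq
  have hκ : 0 < 4 * (q - 1) / q ^ 2 := div_pos (by linarith) (by positivity)
  refine ⟨Integrable.congr (Integrable.bdd_mul (c := M ^ (q - 1)) hf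
    (hw.pow_const (q - 1)).aestronglyMeasurable
    (Eventually.of_forall fun x => hbd (q - 1) (by linarith) x)) hpf, ?_⟩
  obtain ⟨g, hg, hgL, hgA⟩ := FracLap.exists_hasFracLap (s := s / 2) (by linarith) (by linarith)
    (hw.pow_const (q / 2)) (hbd (q / 2) (by linarith))
    -- With this `A`, the norm bound from Riesz is exactly the claimed inequality.
    (A := (∫ x, w x ^ (q - 1) * f x) / (4 * (q - 1) / q ^ 2)) (div_nonneg hA hκ.le)
    (fun ψ hψ => by
      rw [div_mul_eq_mul_div, le_div_iff₀ hκ, mul_comm]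
      exact hE ψ hψ)
  refine ⟨g, hg, hgL.congr_left (hpow _), ?_⟩
  rw [← integral_congr_ae hpf, mul_comm]
  exact (le_div_iff₀ hκ).1 hgA
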